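/- Let $\Omega\subset\mathbb R^3$ be a bounded open set with boundary of class $C^2$ and outer unit normal $\nu$, let $\Gamma\subseteq\partial\Omega$ be relatively open, and let $ds$ be the surface measure on $\partial\Omega$. For $P\in H^1(\Omega,\mathbb R^{3\times3})$ put $(\mathrm DP)_{ijk}=\partial_kP_{ij}$; let $P\times\nu$ denote the row-wise cross product, $\operatorname{dev}A=A-\tfrac13\operatorname{tr}(A)\mathbb 1$, $(\mathfrak m\cdot\nu)_{ij}=\sum_h\mathfrak m_{ijh}\nu_h$ and $(\operatorname{DIV}\mathfrak m)_{ij}=\sum_k\partial_k\mathfrak m_{ijk}$. Let $$\mathscr H^\sharp(\Omega)=\{P\in H^1(\Omega,\mathbb R^{3\times3}) : P\times\nu|_\Gamma=0\}$$ (in the sense of traces). For real parameters $\mu,L_c,a_1,a_2,a_3$ consider the curvature energy $$\mathscr F_{\rm curv}[P]=\int_\Omega\frac{\mu L_c^2}{2}\Big(a_1\|\mathrm D(\operatorname{dev}\operatorname{sym}P)\|^2+a_2\|\mathrm D(\operatorname{skew}P)\|^2+\tfrac29a_3\|\mathrm D(\operatorname{tr}(P)\mathbb 1)\|^2\Big)dV,$$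 its first variation $\delta\mathscr F_{\rm curv}[P,\delta P]=\frac{d}{dt}\big|_{t=0}\mathscr F_{\rm curv}[P+t\,\delta P]$, and the moment stress tensor $$\mathfrak m=\mu L_c^2\Big(a_1\mathrm D(\operatorname{dev}\operatorname{sym}P)+a_2\mathrm D(\operatorname{skew}P)+\tfrac23a_3\mathrm D(\operatorname{tr}(P)\mathbb 1)\Big).$$ Let $P\in\mathscr H^\sharp(\Omega)\cap C^2(\overline\Omega,\mathbb R^{3\times3})$. 1. For every $\delta P\in\mathscr H^\sharp(\Omega)$ one has $\delta P=\delta P\cdot(\nu\otimes\nu)$ a.e. on $\Gamma$, the derivative defining $\delta\mathscr F_{\rm curv}[P,\delta P]$ exists, and, if $\overline\Gamma\setminus\Gamma$ has surface measure zero, $$\delta\mathscr F_{\rm curv}[P,\delta P]=\int_\Gamma\langle(\mathfrak m\cdot\nu)\cdot(\nu\otimes\nu),\delta P\cdot(\nu\otimes\nu)\rangle\,ds+\int_{\partial\Omega\setminus\overline\Gamma}\langle\mathfrak m\cdot\nu,\delta P\rangle\,ds-\int_\Omega\langle\operatorname{DIV}\mathfrak m,\delta P\rangle\,dV.$$ 2.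 If $\delta\mathscr F_{\rm curv}[P,\delta P]=0$ for all $\delta P\in\mathscr H^\sharp(\Omega)$, then $$\operatorname{DIV}\mathfrak m=0\ \text{in }\Omega,\qquad(\mathfrak m\cdot\nu)\cdot(\nu\otimes\nu)=0\ \text{on }\Gamma,\qquad\mathfrak m\cdot\nu=0\ \text{on }\partial\Omega\setminus\overline\Gamma.$$ Conversely, if $\overline\Gamma\setminus\Gamma$ has surface measure zero, these three conditions imply $\delta\mathscr F_{\rm curv}[P,\delta P]=0$ for all $\delta P\in\mathscr H^\sharp(\Omega)$. 3. At every point of $\Gamma$, $(\mathfrak m\cdot\nu)\cdot(\nu\otimes\nu)=0$ if and only if $(\mathfrak m\cdot\nu)\cdot\nu=0$. -/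

import Mathlib

open MeasureTheory Filter Topology

noncomputable section

namespace Micromorphic

/-- Euclidean three-space. -/
abbrev Vec3 := EuclideanSpace ℝ (Fin 3)

/-- Second order tensors. -/
abbrev Mat3 := Matrix (Fin 3) (Fin 3) ℝ

/-- Third order tensors. -/
abbrev Tensor3 := Fin 3 → Fin 3 → Fin 3 → ℝ

/-! ### Tensor algebra -/

/-- Symmetric part. -/
def sym (A : Mat3) : Mat3 := (1 / 2 : ℝ) • (A + A.transpose)

/-- Skew-symmetric part. -/
def skew (A : Mat3) : Mat3 := (1 / 2 : ℝ) • (A - A.transpose)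

/-- Deviatoric (trace-free) part. -/
def dev (A : Mat3) : Mat3 := A - (A.trace / 3) • (1 : Mat3)

/-- Frobenius scalar product of matrices. -/
def mdot (A B : Mat3) : ℝ := ∑ i, ∑ j, A i j * B i j

/-- Squared Euclidean norm of a third order tensor. -/
def tnormSq (M : Tensor3) : ℝ := ∑ i, ∑ j, ∑ k, M i j k ^ 2

/-- The linear operation `L` on matrices applied, for every fixed last index, to the first two
indices. If `M = D P` (that is, `M i j k = ∂ₖ Pᵢⱼ`) this is `D (L P)`. -/
def onSlices (L : Mat3 → Mat3) (M : Tensor3) : Tensor3 :=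
  fun i j k => L (Matrix.of fun i' j' => M i' j' k) i j

/-- The contraction `(m · u)ᵢⱼ = ∑ₕ mᵢⱼₕ uₕ`. -/
def tdot (m : Tensor3) (u : Vec3) : Mat3 := Matrix.of fun i j => ∑ h, m i j h * u h

/-- The contraction `(A · u)ᵢ = ∑ⱼ Aᵢⱼ uⱼ`. -/
def vdot (A : Mat3) (u : Vec3) : Fin 3 → ℝ := A.mulVec (fun j => u j)

/-- The dyadic square `u ⊗ u`. -/
def dyad (u : Vec3) : Mat3 := Matrix.of fun i j => u i * u j

/-- The row-wise cross product `(A × u)ᵢⱼ = ((A)ᵢ × u)ⱼ`. -/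
def rowCross (A : Mat3) (u : Vec3) : Mat3 :=
  Matrix.of fun i => crossProduct (fun j => A i j) (fun j => u j)

/-! ### Differential operators -/

/-- The `k`-th partial derivative. -/
def pderiv (k : Fin 3) (f : Vec3 → ℝ) (x : Vec3) : ℝ :=
  fderiv ℝ f x (EuclideanSpace.single k 1)

/-- The classical gradient `(D P)ᵢⱼₖ = ∂ₖ Pᵢⱼ`. -/
def grad (P : Vec3 → Mat3) (x : Vec3) : Tensor3 :=
  fun i j k => pderiv k (fun y => P y i j) x

/-- The divergence `(DIV m)ᵢⱼ = ∑ₖ ∂ₖ mᵢⱼₖ`. -/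
def DIV (m : Vec3 → Tensor3) (x : Vec3) : Mat3 :=
  Matrix.of fun i j => ∑ k, pderiv k (fun y => m y i j k) x

/-! ### Domains with `C²` boundary -/

/-- `ρ` is a `C²` defining function of `Ω` near the point `x`. -/
def IsDefiningFunctionAt (Ω : Set Vec3) (x : Vec3) (ρ : Vec3 → ℝ) : Prop :=
  ContDiff ℝ 2 ρ ∧ gradient ρ x ≠ 0 ∧ ∀ᶠ y in 𝓝 x, (y ∈ Ω ↔ ρ y < 0)

/-- `Ω` lies locally on one side of its boundary, which is a surface of class `C²`. -/
def HasC2Boundary (Ω : Set Vec3) : Prop :=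
  ∀ x ∈ frontier Ω, ∃ ρ, IsDefiningFunctionAt Ω x ρ

open Classical in
/-- The outer unit normal `∇ρ / |∇ρ|` of `Ω` at a boundary point, `ρ` being any local defining
function (the value does not depend on which one). -/
def outerNormal (Ω : Set Vec3) (x : Vec3) : Vec3 :=
  if h : ∃ ρ, IsDefiningFunctionAt Ω x ρ then ‖gradient h.choose x‖⁻¹ • gradient h.choose x else 0

/-- The surface measure on `∂Ω`: two-dimensional Hausdorff measure, normalized as surface area. -/
def surf (Ω : Set Vec3) : Measure Vec3 :=
  (Measure.euclideanHausdorffMeasure 2 : Measure Vec3).restrict (frontier Ω)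

/-! ### The Sobolev space `H¹`, traces, and the space `ℋ^♯` -/

/-- `P` and `G` are square integrable on `Ω`, and `G` is the weak gradient of `P` in `Ω`. -/
def HasWeakGrad (Ω : Set Vec3) (P : Vec3 → Mat3) (G : Vec3 → Tensor3) : Prop :=
  (∀ i j, MemLp (fun x => P x i j) 2 (volume.restrict Ω)) ∧
  (∀ i j k, MemLp (fun x => G x i j k) 2 (volume.restrict Ω)) ∧
  ∀ i j k, ∀ φ : Vec3 → ℝ, ContDiff ℝ (⊤ : ℕ∞) φ → HasCompactSupport φ → tsupport φ ⊆ Ω →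
    ∫ x in Ω, P x i j * pderiv k φ x = -∫ x in Ω, G x i j k * φ x

/-- `P ∈ H¹(Ω, ℝ^{3×3})`. -/
def MemH1 (Ω : Set Vec3) (P : Vec3 → Mat3) : Prop := ∃ G, HasWeakGrad Ω P G

open Classical in
/-- The weak gradient `D P` of `P ∈ H¹(Ω, ℝ^{3×3})` (unique up to null sets). -/
def weakGrad (Ω : Set Vec3) (P : Vec3 → Mat3) : Vec3 → Tensor3 :=
  if h : MemH1 Ω P then h.choose else 0

/-- `g ∈ L²(∂Ω, ℝ^{3×3})` is the boundary trace of `P ∈ H¹(Ω, ℝ^{3×3})`: the trace operator is the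
closure, in `H¹(Ω) × L²(∂Ω)`, of the restriction map on fields of class `C¹` up to the boundary. -/
def IsTrace (Ω : Set Vec3) (P g : Vec3 → Mat3) : Prop :=
  MemH1 Ω P ∧ (∀ i j, MemLp (fun x => g x i j) 2 (surf Ω)) ∧
  ∃ Q : ℕ → Vec3 → Mat3,
    (∀ n i j, ContDiff ℝ 1 (fun x => Q n x i j)) ∧
    (∀ i j, Tendsto (fun n => eLpNorm (fun x => Q n x i j - P x i j) 2 (volume.restrict Ω))
      atTop (𝓝 0)) ∧
    (∀ i j k, Tendsto
      (fun n => eLpNorm (fun x => grad (Q n) x i j k - weakGrad Ω P x i j k) 2 (volume.restrict Ω))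
      atTop (𝓝 0)) ∧
    (∀ i j, Tendsto (fun n => eLpNorm (fun x => Q n x i j - g x i j) 2 (surf Ω)) atTop (𝓝 0))

/-- The matrix field `g` has vanishing tangential part on `Γ`: `g × ν = 0` almost everywhere. -/
def TangentiallyZero (Ω Γ : Set Vec3) (g : Vec3 → Mat3) : Prop :=
  ∀ᵐ x ∂(surf Ω).restrict Γ, rowCross (g x) (outerNormal Ω x) = 0

/-- `P ∈ ℋ^♯(Ω)`: `P ∈ H¹(Ω, ℝ^{3×3})` and `P × ν = 0` on `Γ` in the sense of traces. -/
def MemHsharp (Ω Γ : Set Vec3) (P : Vec3 → Mat3) : Prop :=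
  ∃ g, IsTrace Ω P g ∧ TangentiallyZero Ω Γ g

/-! ### Curvature energy, moment stress -/

/-- The constitutive parameters of the curvature energy. -/
structure CurvParams where
  μ : ℝ
  Lc : ℝ
  a₁ : ℝ
  a₂ : ℝ
  a₃ : ℝ

/-- The curvature energy density as a function of `M = D P`, that is
`μ Lc² / 2 (a₁ |D dev sym P|² + a₂ |D skew P|² + 2/9 a₃ |D (tr P · 1)|²)`. -/
def Wcurv (c : CurvParams) (M : Tensor3) : ℝ :=
  c.μ * c.Lc ^ 2 / 2 *
    (c.a₁ * tnormSq (onSlices (fun A => dev (sym A)) M) + c.a₂ * tnormSq (onSlices skew M) +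
      2 / 9 * c.a₃ * tnormSq (onSlices (fun A => A.trace • (1 : Mat3)) M))

/-- The curvature energy functional on `H¹(Ω, ℝ^{3×3})`. -/
def curvEnergy (c : CurvParams) (Ω : Set Vec3) (P : Vec3 → Mat3) : ℝ :=
  ∫ x in Ω, Wcurv c (weakGrad Ω P x)

/-- The first variation (Gâteaux derivative) of the curvature energy at `P` in direction `δP`. -/
def curvVariation (c : CurvParams) (Ω : Set Vec3) (P δP : Vec3 → Mat3) : ℝ :=
  deriv (fun t : ℝ => curvEnergy c Ω (P + t • δP)) 0

/-- The third order moment stress tensor, conjugate to `D P` for the density `Wcurv`. The factor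
`2/3 = 3 · 2/9` of the last term is due to `⟨1, 1⟩ = 3`. -/
def momentStress (c : CurvParams) (P : Vec3 → Mat3) (x : Vec3) : Tensor3 :=
  (c.μ * c.Lc ^ 2) •
    (c.a₁ • grad (fun y => dev (sym (P y))) x + c.a₂ • grad (fun y => skew (P y)) x +
      (2 / 3 * c.a₃) • grad (fun y => (P y).trace • (1 : Mat3)) x)

end Micromorphic

end

open Micromorphic

/-!
The curvature energy density is a quadratic form in `D P` whose gradient at `D P` is the moment
stress `𝔪`, so the first variation at `P` in the direction `δP` is `∫_Ω ⟨𝔪, D(δP)⟩`. Since traces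
are `L²(∂Ω)`-limits of restrictions of `C¹` fields, Green's formula for `δP` follows by
approximation from the divergence theorem for `C¹` fields, which a partition of unity reduces to the
region below a graph; there the surface measure is given by the area formula. For a unit vector `ν`
the condition `A × ν = 0` means `A = A (ν ⊗ ν)`, hence only the normal component of the traction
`𝔪 ν` works against an admissible variation on `Γ`.

Conversely, test with `φ B`, where `φ` is a bump function. Constant `B` gives the bulk equation and
the natural condition away from the closure of `Γ`. At a point of `Γ` the choice `B = eᵢ ⊗ ∇ρ`, with
`ρ` a local defining function of `Ω`, is admissible because `∇ρ` is parallel to `ν` on `∂Ω`. Bump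
functions detect pointwise vanishing on `∂Ω` because every boundary point lies in the support of the
surface measure.
-/

namespace Micromorphic

open scoped NNReal ENNReal

/-! ### The area formula for immersions -/

section MeasureComparison

variable {X : Type*} [TopologicalSpace X] [MeasurableSpace X] {μ ν : Measure X}

theorem measure_le_mul_of_locally_le_mul [OpensMeasurableSpace X] [SecondCountableTopology X]
    {K : ℝ≥0∞}
    (h : ∀ x, ∃ U ∈ 𝓝 x, ∀ A ⊆ U, MeasurableSet A → μ A ≤ K * ν A) {A : Set X}
    (hA : MeasurableSet A) : μ A ≤ K * ν A := by
  choose U hU hμν using h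
  obtain ⟨s, hs, hcover⟩ :=
    TopologicalSpace.countable_cover_nhds fun x => interior_mem_nhds.2 (hU x)
  obtain ⟨V, hV, hVcover⟩ := (Set.exists_seq_cover_iff_countable
      (p := fun V => IsOpen V ∧ ∀ A ⊆ V, MeasurableSet A → μ A ≤ K * ν A)
      ⟨∅, isOpen_empty, fun A hA _ => by simp [Set.subset_empty_iff.1 hA]⟩).2
    ⟨(fun x => interior (U x)) '' s, hs.image _,
      Set.forall_mem_image.2 fun x _ =>
        ⟨isOpen_interior, fun A hA => hμν x A (hA.trans interior_subset)⟩,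
      by rw [Set.sUnion_image, hcover]⟩
  have hpieces : ∀ n, MeasurableSet (A ∩ disjointed V n) := fun n =>
    hA.inter (.disjointed (fun m => (hV m).1.measurableSet) n)
  have hdisjoint : Pairwise (Function.onFun Disjoint fun n => A ∩ disjointed V n) :=
    fun i j hij => (disjoint_disjointed V hij).mono Set.inter_subset_right Set.inter_subset_right
  have hunion : A = ⋃ n, A ∩ disjointed V n := by
    rw [← Set.inter_iUnion, iUnion_disjointed, hVcover, Set.inter_univ]
  rw [hunion, measure_iUnion hdisjoint hpieces, measure_iUnion hdisjoint hpieces,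
    ← ENNReal.tsum_mul_left]
  exact ENNReal.tsum_le_tsum fun n =>
    (hV n).2 _ (Set.inter_subset_right.trans (disjointed_subset V n)) (hpieces n)

theorem measure_le_of_locally_le_pow_mul [OpensMeasurableSpace X] [SecondCountableTopology X]
    (n : ℕ)
    (h : ∀ K : ℝ≥0, 1 < K → ∀ x, ∃ U ∈ 𝓝 x, ∀ A ⊆ U, MeasurableSet A →
      μ A ≤ (K : ℝ≥0∞) ^ n * ν A) :
    μ ≤ ν := by
  refine Measure.le_iff.2 fun A hA => ?_
  by_cases htop : ν A = ∞
  · simp [htop]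
  have hcont : ContinuousAt (fun K : ℝ≥0 => (K : ℝ≥0∞) ^ n) 1 := by fun_prop
  have hlim : Tendsto (fun K : ℝ≥0 => (K : ℝ≥0∞) ^ n * ν A) (𝓝[>] 1) (𝓝 (ν A)) := by
    simpa using ENNReal.Tendsto.mul_const (hcont.tendsto.mono_left nhdsWithin_le_nhds)
      (Or.inr htop)
  exact ge_of_tendsto hlim (eventually_nhdsWithin_of_forall fun K hK =>
    measure_le_mul_of_locally_le_mul (h K hK) hA)

theorem exists_nhds_withDensity_comparable {J : X → ℝ≥0∞} {x : X} (hJ : ContinuousAt J x)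
    (hpos : J x ≠ 0) (hfin : J x ≠ ∞) {K : ℝ≥0} (hK : 1 < K) :
    ∃ U ∈ 𝓝 x, ∀ A ⊆ U, MeasurableSet A →
      ν.withDensity J A ≤ K * (J x * ν A) ∧ J x * ν A ≤ K * ν.withDensity J A := by
  have hlt : J x < K * J x := by
    simpa using ENNReal.mul_lt_mul_left hpos hfin (ENNReal.one_lt_coe_iff.2 hK)
  have hKJ : ContinuousAt (fun y => K * J y) x :=
    ENNReal.Tendsto.const_mul hJ (Or.inr ENNReal.coe_ne_top)
  refine ⟨_, (hJ.eventually_lt_const hlt).and (hKJ.eventually_const_lt hlt), fun A hAU hA => ?_⟩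
  rw [withDensity_apply _ hA]
  constructor
  · rw [← mul_assoc, ← setLIntegral_const]
    exact setLIntegral_mono' hA fun y hy => (hAU hy).1.le
  · rw [← setLIntegral_const, ← lintegral_const_mul' _ _ ENNReal.coe_ne_top]
    exact setLIntegral_mono' hA fun y hy => (hAU hy).2.le

end MeasureComparison

theorem euclideanHausdorffMeasure_image_le_of_edist_le {X Y Z : Type*} [EMetricSpace Y]
    [MeasurableSpace Y] [BorelSpace Y] [EMetricSpace Z] [MeasurableSpace Z] [BorelSpace Z]
    {f : X → Y} {g : X → Z} {A : Set X} {K : ℝ≥0}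
    (h : ∀ x ∈ A, ∀ y ∈ A, edist (f x) (f y) ≤ K * edist (g x) (g y)) (d : ℕ) :
    μHE[d] (f '' A) ≤ (K : ℝ≥0∞) ^ d * μHE[d] (g '' A) := by
  rcases A.eq_empty_or_nonempty with rfl | ⟨a, -⟩
  · simp
  have : Nonempty X := ⟨a⟩
  set s := Function.invFunOn g A
  have hsA : ∀ z ∈ g '' A, s z ∈ A := fun z hz => Function.invFunOn_mem hz
  have hgs : ∀ z ∈ g '' A, g (s z) = z := fun z hz => Function.invFunOn_eq hz
  have hlipschitz : LipschitzOnWith K (f ∘ s) (g '' A) := fun z hz w hw => by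
    simpa only [Function.comp_apply, hgs z hz, hgs w hw] using h _ (hsA z hz) _ (hsA w hw)
  have himage : f '' A = f ∘ s '' (g '' A) := by
    rw [Set.image_image]
    refine Set.image_congr fun x hx => edist_le_zero.1 ?_
    have hgx := Set.mem_image_of_mem g hx
    simpa [hgs _ hgx] using h x hx _ (hsA _ hgx)
  have hμH := hlipschitz.hausdorffMeasure_image_le (d := (d : ℝ)) (by positivity)
  rw [← himage, ENNReal.rpow_natCast] at hμH
  simp only [Measure.euclideanHausdorffMeasure_def, Measure.smul_apply, ENNReal.smul_def,
    smul_eq_mul]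
  rw [mul_left_comm]
  gcongr

theorem exists_nhds_edist_comparable {𝕜 F E : Type*}
    [NontriviallyNormedField 𝕜] [NormedAddCommGroup F] [NormedSpace 𝕜 F] [NormedAddCommGroup E]
    [NormedSpace 𝕜 E] {f : F → E} {L : F →L[𝕜] E} {y₀ : F} (hf : HasStrictFDerivAt f L y₀)
    {C : ℝ≥0} (hL : AntilipschitzWith C L) {K : ℝ≥0} (hK : 1 < K) :
    ∃ U ∈ 𝓝 y₀, ∀ x ∈ U, ∀ y ∈ U, edist (f x) (f y) ≤ K * edist (L x) (L y) ∧
      edist (L x) (L y) ≤ K * edist (f x) (f y) := by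
  have hK' : (1 : ℝ) < K := by exact_mod_cast hK
  have hδ : 0 < 1 - (K : ℝ)⁻¹ := sub_pos.2 (inv_lt_one_of_one_lt₀ hK')
  have hε : 0 < (1 - (K : ℝ)⁻¹) / (C + 1) := by positivity
  obtain ⟨U, hU, happrox⟩ := hf.approximates_deriv_on_nhds
    (c := ⟨(1 - (K : ℝ)⁻¹) / (C + 1), hε.le⟩) (Or.inr hε)
  refine ⟨U, hU, fun x hx y hy => ?_⟩
  have herror : ‖f x - f y - (L x - L y)‖ ≤ (1 - (K : ℝ)⁻¹) * dist (L x) (L y) := by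
    calc ‖f x - f y - (L x - L y)‖
        ≤ (1 - (K : ℝ)⁻¹) / (C + 1) * ‖x - y‖ := by
          rw [← map_sub]
          exact happrox x hx y hy
      _ ≤ (1 - (K : ℝ)⁻¹) / (C + 1) * ((C + 1) * dist (L x) (L y)) := by
          gcongr
          rw [← dist_eq_norm]
          have hanti := hL.le_mul_dist x y
          nlinarith [dist_nonneg (x := L x) (y := L y)]
      _ = (1 - (K : ℝ)⁻¹) * dist (L x) (L y) := by field_simp
  have hupper := norm_sub_norm_le (f x - f y) (L x - L y)
  have hlower := norm_sub_norm_le (L x - L y) (f x - f y)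
  rw [norm_sub_rev (L x - L y)] at hlower
  rw [← dist_eq_norm (f x), ← dist_eq_norm (L x)] at hupper hlower
  have hKK : (K : ℝ) * (K : ℝ)⁻¹ = 1 := mul_inv_cancel₀ (by positivity)
  have htwo : 2 ≤ (K : ℝ) + (K : ℝ)⁻¹ := by nlinarith [mul_pos hδ (sub_pos.2 hK')]
  have hfL : dist (f x) (f y) ≤ K * dist (L x) (L y) := by
    nlinarith [dist_nonneg (x := L x) (y := L y)]
  have hLf : dist (L x) (L y) ≤ K * dist (f x) (f y) := by
    calc dist (L x) (L y) = K * ((K : ℝ)⁻¹ * dist (L x) (L y)) := by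
          rw [← mul_assoc, hKK, one_mul]
      _ ≤ K * dist (f x) (f y) := by gcongr; linarith
  simp only [edist_nndist]
  exact ⟨by exact_mod_cast hfL, by exact_mod_cast hLf⟩

section AreaFormula

variable {F E : Type*} [NormedAddCommGroup F] [InnerProductSpace ℝ F] [FiniteDimensional ℝ F]
  [NormedAddCommGroup E] [InnerProductSpace ℝ E]

theorem continuous_normDet : Continuous fun L : F →L[ℝ] E => (L : F →ₗ[ℝ] E).normDet := by
  have hsqrt : ∀ L : F →L[ℝ] E, (L : F →ₗ[ℝ] E).normDet =
      √(Matrix.gram ℝ fun i => L (stdOrthonormalBasis ℝ F i)).det := fun L => by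
    rw [← Real.sqrt_sq (LinearMap.normDet_nonneg _)]
    exact congrArg Real.sqrt (LinearMap.normDet_sq_eq_det_gram _ (stdOrthonormalBasis ℝ F))
  simp only [hsqrt]
  refine (Continuous.matrix_det (continuous_matrix fun i j => ?_)).sqrt
  simp only [Matrix.gram_apply]
  fun_prop

variable [MeasurableSpace F] [BorelSpace F] [MeasurableSpace E] [BorelSpace E] {f : F → E}

theorem exists_nhds_comap_euclideanHausdorffMeasure_comparable (hf : ContDiff ℝ 1 f)
    (hemb : MeasurableEmbedding f) (hdf : ∀ y, Function.Injective (fderiv ℝ f y)) {K : ℝ≥0}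
    (hK : 1 < K) (y₀ : F) :
    ∃ U ∈ 𝓝 y₀, ∀ A ⊆ U, MeasurableSet A →
      (μHE[Module.finrank ℝ F].comap f) A ≤ (K : ℝ≥0∞) ^ (Module.finrank ℝ F + 1) *
        volume.withDensity (fun y => .ofReal (fderiv ℝ f y : F →ₗ[ℝ] E).normDet) A ∧
      volume.withDensity (fun y => .ofReal (fderiv ℝ f y : F →ₗ[ℝ] E).normDet) A ≤
        (K : ℝ≥0∞) ^ (Module.finrank ℝ F + 1) * (μHE[Module.finrank ℝ F].comap f) A := by
  set L := fderiv ℝ f y₀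
  set J : F → ℝ≥0∞ := fun y => .ofReal (fderiv ℝ f y : F →ₗ[ℝ] E).normDet with hJdef
  have hker : (L : F →ₗ[ℝ] E).ker = ⊥ := LinearMap.ker_eq_bot.2 (hdf y₀)
  obtain ⟨C, -, hC⟩ := (L : F →ₗ[ℝ] E).exists_antilipschitzWith hker
  have hJ : Continuous J :=
    ENNReal.continuous_ofReal.comp (continuous_normDet.comp (hf.continuous_fderiv one_ne_zero))
  have hJpos : J y₀ ≠ 0 := by
    simpa [hJdef] using (LinearMap.normDet_nonneg _).lt_of_ne'
      (mt LinearMap.normDet_eq_zero_iff_ker_ne_bot.1 (not_not.2 hker))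
  obtain ⟨U, hU, hfL⟩ :=
    exists_nhds_edist_comparable (hf.hasStrictFDerivAt one_ne_zero (x := y₀)) hC hK
  obtain ⟨V, hV, hJA⟩ := exists_nhds_withDensity_comparable (ν := volume) hJ.continuousAt hJpos
    ENNReal.ofReal_ne_top hK
  refine ⟨U ∩ V, inter_mem hU hV, fun A hA hAm => ?_⟩
  have hLA : μHE[Module.finrank ℝ F] (L '' A) = J y₀ * volume A :=
    (L : F →ₗ[ℝ] E).euclideanHausdorffMeasure_image_eq_normDet_mul_volume A
  obtain ⟨hJle, hleJ⟩ := hJA A (hA.trans Set.inter_subset_right) hAm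
  have hfle := euclideanHausdorffMeasure_image_le_of_edist_le
    (fun x hx y hy => (hfL x (hA hx).1 y (hA hy).1).1) (Module.finrank ℝ F)
  have hlef := euclideanHausdorffMeasure_image_le_of_edist_le
    (fun x hx y hy => (hfL x (hA hx).1 y (hA hy).1).2) (Module.finrank ℝ F)
  rw [hLA] at hfle hlef
  rw [hemb.comap_apply]
  constructor
  · rw [pow_succ, mul_assoc]
    exact hfle.trans (by gcongr)
  · rw [pow_succ', mul_assoc]
    exact hJle.trans (by gcongr)

theorem comap_euclideanHausdorffMeasure_eq_withDensity_normDet (hf : ContDiff ℝ 1 f)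
    (hemb : MeasurableEmbedding f) (hdf : ∀ y, Function.Injective (fderiv ℝ f y)) :
    μHE[Module.finrank ℝ F].comap f =
      volume.withDensity fun y => .ofReal (fderiv ℝ f y : F →ₗ[ℝ] E).normDet := by
  -- Near each point `f` distorts lengths like its derivative up to a factor `K`; let `K → 1`.
  have hlocal := fun K hK y =>
    exists_nhds_comap_euclideanHausdorffMeasure_comparable hf hemb hdf (K := K) hK y
  refine le_antisymm
    (measure_le_of_locally_le_pow_mul (Module.finrank ℝ F + 1) fun K hK y => ?_)
    (measure_le_of_locally_le_pow_mul (Module.finrank ℝ F + 1) fun K hK y => ?_)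
  all_goals obtain ⟨U, hU, hUA⟩ := hlocal K hK y
  · exact ⟨U, hU, fun A hA hAm => (hUA A hA hAm).1⟩
  · exact ⟨U, hU, fun A hA hAm => (hUA A hA hAm).2⟩

end AreaFormula

section Graph

variable {F E : Type*} [NormedAddCommGroup F] [InnerProductSpace ℝ F] [NormedAddCommGroup E]
  [InnerProductSpace ℝ E]

/-- The parametrization `y ↦ T (y, ψ y)` of the graph of `ψ`, in orthonormal coordinates of the
ambient space given by the isometry `T`. -/
noncomputable def graphMap (T : WithLp 2 (F × ℝ) ≃ₗᵢ[ℝ] E) (ψ : F → ℝ) (y : F) : E :=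
  T (WithLp.toLp 2 (y, ψ y))

variable {T : WithLp 2 (F × ℝ) ≃ₗᵢ[ℝ] E} {ψ : F → ℝ}

theorem leftInverse_graphMap :
    Function.LeftInverse (fun x => (T.symm x).fst) (graphMap T ψ) := fun y => by
  simp [graphMap]

theorem contDiff_graphMap {n : WithTop ℕ∞} (hψ : ContDiff ℝ n ψ) :
    ContDiff ℝ n (graphMap T ψ) :=
  T.contDiff.comp (WithLp.contDiff_toLp.comp (contDiff_id.prodMk hψ))

theorem fderiv_graphMap (y : F) (hψ : DifferentiableAt ℝ ψ y) (v : F) :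
    fderiv ℝ (graphMap T ψ) y v = T (WithLp.toLp 2 (v, fderiv ℝ ψ y v)) := by
  let S : F × ℝ →L[ℝ] E := (T : WithLp 2 (F × ℝ) →L[ℝ] E) ∘L
    ((WithLp.prodContinuousLinearEquiv 2 ℝ F ℝ).symm : F × ℝ →L[ℝ] WithLp 2 (F × ℝ))
  have hS : HasFDerivAt (graphMap T ψ)
      (S ∘L (ContinuousLinearMap.id ℝ F).prod (fderiv ℝ ψ y)) y :=
    S.hasFDerivAt.comp y ((hasFDerivAt_id y).prodMk hψ.hasFDerivAt)
  rw [hS.fderiv]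
  rfl

variable [FiniteDimensional ℝ F]

/-- The density `√(1 + |∇ψ|²)` of the surface measure of the graph of `ψ` with respect to the
Lebesgue measure of the parameter space. -/
noncomputable def areaDensity (ψ : F → ℝ) (y : F) : ℝ := √(1 + ‖gradient ψ y‖ ^ 2)

theorem one_le_areaDensity (ψ : F → ℝ) (y : F) : 1 ≤ areaDensity ψ y :=
  Real.one_le_sqrt.2 (le_add_of_nonneg_right (sq_nonneg _))

theorem continuous_gradient {ψ : F → ℝ} (hψ : ContDiff ℝ 1 ψ) : Continuous (gradient ψ) :=
  (InnerProductSpace.toDual ℝ F).symm.continuous.comp (hψ.continuous_fderiv one_ne_zero)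

theorem continuous_areaDensity {ψ : F → ℝ} (hψ : ContDiff ℝ 1 ψ) : Continuous (areaDensity ψ) :=
  (continuous_const.add ((continuous_gradient hψ).norm.pow 2)).sqrt

theorem normDet_fderiv_graphMap {y : F} (hψ : DifferentiableAt ℝ ψ y) :
    (fderiv ℝ (graphMap T ψ) y : F →ₗ[ℝ] E).normDet = areaDensity ψ y := by
  have : FiniteDimensional ℝ E := FiniteDimensional.of_injective
    (T.symm.toLinearEquiv : E →ₗ[ℝ] WithLp 2 (F × ℝ)) T.symm.injective
  set L := fderiv ℝ (graphMap T ψ) y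
  have hadjoint : ((ContinuousLinearMap.adjoint L ∘L L : F →L[ℝ] F) : F →ₗ[ℝ] F) =
      LinearMap.transvection (fderiv ℝ ψ y : F →ₗ[ℝ] ℝ) (gradient ψ y) := by
    refine LinearMap.ext fun v => ext_inner_right ℝ fun w => ?_
    have hleft : inner ℝ (ContinuousLinearMap.adjoint L (L v)) w =
        inner ℝ v w + fderiv ℝ ψ y v * fderiv ℝ ψ y w := by
      rw [ContinuousLinearMap.adjoint_inner_left, fderiv_graphMap y hψ, fderiv_graphMap y hψ,
        T.inner_map_map, WithLp.prod_inner_apply]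
      simp [mul_comm]
    simp [hleft, LinearMap.transvection.apply, inner_add_left, inner_smul_left,
      inner_gradient_left]
  have hdet := L.normDet_sq
  rw [ContinuousLinearMap.det, hadjoint, LinearMap.transvection.det] at hdet
  rw [areaDensity, ← Real.sqrt_sq (LinearMap.normDet_nonneg (L : F →ₗ[ℝ] E))]
  simpa [← inner_gradient_left] using congrArg Real.sqrt hdet

variable [MeasurableSpace F] [BorelSpace F] [MeasurableSpace E] [BorelSpace E]

theorem measurableEmbedding_graphMap (hψ : Continuous ψ) : MeasurableEmbedding (graphMap T ψ) :=
  (T.continuous.comp ((WithLp.prod_continuous_toLp 2 F ℝ).comp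
    (continuous_id.prodMk hψ))).measurableEmbedding leftInverse_graphMap.injective

theorem map_graphMap (hψ : ContDiff ℝ 1 ψ) :
    (volume.withDensity fun y => .ofReal (areaDensity ψ y)).map (graphMap T ψ) =
      μHE[Module.finrank ℝ F].restrict (Set.range (graphMap T ψ)) := by
  have hemb := measurableEmbedding_graphMap (T := T) hψ.continuous
  have hdiff : ∀ y, DifferentiableAt ℝ ψ y := hψ.differentiable one_ne_zero
  have hinjective : ∀ y, Function.Injective (fderiv ℝ (graphMap T ψ) y) := fun y v w hvw => by
    simpa [fderiv_graphMap y (hdiff y)] using congrArg (fun x => (T.symm x).fst) hvw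
  rw [← hemb.map_comap,
    comap_euclideanHausdorffMeasure_eq_withDensity_normDet (contDiff_graphMap hψ) hemb hinjective]
  simp only [normDet_fderiv_graphMap (hdiff _)]

end Graph

theorem exists_linearIsometryEquiv_prod {F E : Type*} [NormedAddCommGroup F]
    [InnerProductSpace ℝ F] [FiniteDimensional ℝ F] [NormedAddCommGroup E] [InnerProductSpace ℝ E]
    [FiniteDimensional ℝ E] (hdim : Module.finrank ℝ E = Module.finrank ℝ F + 1) {e : E}
    (he : ‖e‖ = 1) :
    ∃ T : WithLp 2 (F × ℝ) ≃ₗᵢ[ℝ] E, T (WithLp.toLp 2 (0, 1)) = e := by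
  have hfinrank : Module.finrank ℝ (WithLp 2 (F × ℝ)) = Module.finrank ℝ E := by
    rw [hdim, (WithLp.linearEquiv 2 ℝ (F × ℝ)).finrank_eq]
    simp
  let S : WithLp 2 (F × ℝ) ≃ₗᵢ[ℝ] E :=
    (stdOrthonormalBasis ℝ _).equiv (stdOrthonormalBasis ℝ E) (finCongr hfinrank)
  let u := S (WithLp.toLp 2 (0, 1))
  have hu : ‖u‖ = ‖e‖ := by simp [u, he]
  exact ⟨S.trans (ℝ ∙ (u - e))ᗮ.reflection, Submodule.reflection_sub hu⟩

/-! ### Defining functions and the outer normal -/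

section DefiningFunction

variable {E : Type*} [NormedAddCommGroup E] [InnerProductSpace ℝ E]

theorem eventually_neg_of_fderiv_neg {ρ : E → ℝ} {x v : E} (hρ : DifferentiableAt ℝ ρ x)
    (hx : ρ x = 0) (hv : fderiv ℝ ρ x v < 0) : ∀ᶠ t : ℝ in 𝓝[>] 0, ρ (x + t • v) < 0 := by
  have hderiv : deriv (fun t : ℝ => ρ (x + t • v)) 0 = fderiv ℝ ρ x v :=
    (hρ.hasFDerivAt.hasLineDerivAt v).lineDeriv
  have hsign := eventually_nhdsWithin_sign_eq_of_deriv_neg (hderiv ▸ hv) (by simpa using hx)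
  filter_upwards [nhdsWithin_le_nhds hsign, self_mem_nhdsWithin] with t ht htpos
  rwa [sub_eq_add_neg, zero_add, sign_neg (neg_neg_of_pos htpos), sign_eq_neg_one_iff] at ht

theorem fderiv_nonpos_of_fderiv_neg {ρ₁ ρ₂ : E → ℝ} {x : E} (h₁ : DifferentiableAt ℝ ρ₁ x)
    (h₂ : DifferentiableAt ℝ ρ₂ x) (hx₁ : ρ₁ x = 0) (hx₂ : ρ₂ x = 0)
    (h : ∀ᶠ y in 𝓝 x, ρ₁ y < 0 → ρ₂ y < 0) {v : E} (hv : fderiv ℝ ρ₁ x v < 0) :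
    fderiv ℝ ρ₂ x v ≤ 0 := by
  by_contra! hpos
  have hneg := eventually_neg_of_fderiv_neg h₂.neg (neg_eq_zero.2 hx₂)
    (by simpa [fderiv_neg] using hpos)
  have hline : Tendsto (fun t : ℝ => x + t • v) (𝓝[>] 0) (𝓝 x) := by
    have hcont : Continuous fun t : ℝ => x + t • v := by fun_prop
    simpa using (hcont.tendsto 0).mono_left nhdsWithin_le_nhds
  obtain ⟨t, ht₁, ht₂, ht⟩ := ((eventually_neg_of_fderiv_neg h₁ hx₁ hv).and
    (hneg.and (hline.eventually h))).exists
  exact (ht ht₁).not_gt (neg_neg_iff_pos.1 ht₂)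

theorem inv_norm_smul_eq_of_inner_neg {a b : E} (ha : a ≠ 0) (hb : b ≠ 0)
    (h : ∀ v, inner ℝ a v < 0 → inner ℝ b v ≤ 0) : ‖a‖⁻¹ • a = ‖b‖⁻¹ • b := by
  set a' := ‖a‖⁻¹ • a with ha'
  set b' := ‖b‖⁻¹ • b with hb'
  have hna : ‖a'‖ = 1 := norm_smul_inv_norm (𝕜 := ℝ) ha
  have hnb : ‖b'‖ = 1 := norm_smul_inv_norm (𝕜 := ℝ) hb
  by_contra hne
  have hlt : inner ℝ a' b' < 1 := (inner_lt_one_iff_real_of_norm_eq_one hna hnb).2 hne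
  have hav : inner ℝ a (b' - a') = ‖a‖ * (inner ℝ a' b' - 1) := by
    conv_lhs => rw [← smul_inv_smul₀ (norm_ne_zero_iff.2 ha) a, ← ha']
    rw [real_inner_smul_left, inner_sub_right, real_inner_self_eq_norm_sq, hna, one_pow]
  have hbv : inner ℝ b (b' - a') = ‖b‖ * (1 - inner ℝ a' b') := by
    conv_lhs => rw [← smul_inv_smul₀ (norm_ne_zero_iff.2 hb) b, ← hb']
    rw [real_inner_smul_left, inner_sub_right, real_inner_self_eq_norm_sq, hnb, one_pow,
      real_inner_comm]
  refine (h (b' - a') ?_).not_gt ?_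
  · rw [hav]
    exact mul_neg_of_pos_of_neg (norm_pos_iff.2 ha) (sub_neg.2 hlt)
  · rw [hbv]
    exact mul_pos (norm_pos_iff.2 hb) (sub_pos.2 hlt)

end DefiningFunction

theorem eq_zero_of_mem_frontier {X : Type*} [TopologicalSpace X] {D : Set X} (hD : IsOpen D)
    {x : X} (hx : x ∈ frontier D) {ρ : X → ℝ} (hρ : ContinuousAt ρ x)
    (h : ∀ᶠ y in 𝓝 x, (y ∈ D ↔ ρ y < 0)) : ρ x = 0 := by
  rw [hD.frontier_eq] at hx
  refine le_antisymm ?_ (not_lt.1 fun hneg => hx.2 (h.self_of_nhds.2 hneg))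
  by_contra! hpos
  obtain ⟨y, hy, hypos, hyD⟩ := ((mem_closure_iff_frequently.1 hx.1).and_eventually
    ((hρ.eventually_const_lt hpos).and h)).exists
  exact (hyD.1 hy).not_gt hypos

section OuterNormal

variable {Ω : Set Vec3} {x : Vec3}

theorem IsDefiningFunctionAt.differentiableAt {ρ : Vec3 → ℝ} (h : IsDefiningFunctionAt Ω x ρ)
    (y : Vec3) : DifferentiableAt ℝ ρ y :=
  h.1.differentiable two_ne_zero y

theorem IsDefiningFunctionAt.eventually {ρ : Vec3 → ℝ} (h : IsDefiningFunctionAt Ω x ρ) :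
    ∀ᶠ y in 𝓝 x, IsDefiningFunctionAt Ω y ρ := by
  filter_upwards [(continuous_gradient (h.1.of_le one_le_two)).continuousAt.eventually_ne h.2.1,
    h.2.2.eventually_nhds] with y hy hΩy
  exact ⟨h.1, hy, hΩy⟩

theorem outerNormal_eq (hΩ : IsOpen Ω) (hx : x ∈ frontier Ω) {ρ : Vec3 → ℝ}
    (h : IsDefiningFunctionAt Ω x ρ) : outerNormal Ω x = ‖gradient ρ x‖⁻¹ • gradient ρ x := by
  have hex : ∃ ρ, IsDefiningFunctionAt Ω x ρ := ⟨ρ, h⟩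
  have hzero : ∀ {ρ}, IsDefiningFunctionAt Ω x ρ → ρ x = 0 := fun hρ =>
    eq_zero_of_mem_frontier hΩ hx hρ.1.continuous.continuousAt hρ.2.2
  obtain ⟨h₀, hne, hmem⟩ := hex.choose_spec
  rw [outerNormal, dif_pos hex]
  refine inv_norm_smul_eq_of_inner_neg hne h.2.1 fun v hv => ?_
  rw [inner_gradient_left] at hv ⊢
  refine fderiv_nonpos_of_fderiv_neg (h₀.differentiable two_ne_zero x) (h.differentiableAt x)
    (hzero hex.choose_spec) (hzero h) ?_ hv
  filter_upwards [hmem, h.2.2] with y hy₀ hy using fun hneg => hy.1 (hy₀.2 hneg)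

theorem norm_outerNormal (hΩ : IsOpen Ω) (hΩ2 : HasC2Boundary Ω) (hx : x ∈ frontier Ω) :
    ‖outerNormal Ω x‖ = 1 := by
  obtain ⟨ρ, hρ⟩ := hΩ2 x hx
  rw [outerNormal_eq hΩ hx hρ]
  exact norm_smul_inv_norm (𝕜 := ℝ) hρ.2.1

theorem continuousOn_outerNormal (hΩ : IsOpen Ω) (hΩ2 : HasC2Boundary Ω) :
    ContinuousOn (outerNormal Ω) (frontier Ω) := by
  intro x hx
  obtain ⟨ρ, hρ⟩ := hΩ2 x hx
  have hgrad := (continuous_gradient (hρ.1.of_le one_le_two)).continuousAt (x := x)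
  have hcont : ContinuousAt (fun y => ‖gradient ρ y‖⁻¹ • gradient ρ y) x :=
    (hgrad.norm.inv₀ (norm_ne_zero_iff.2 hρ.2.1)).smul hgrad
  refine hcont.continuousWithinAt.congr_of_eventuallyEq ?_ (outerNormal_eq hΩ hx hρ)
  filter_upwards [self_mem_nhdsWithin, nhdsWithin_le_nhds hρ.eventually] with y hy hρy
  exact outerNormal_eq hΩ hy hρy

end OuterNormal

/-! ### Graph charts of the boundary -/

theorem exists_contDiff_eventuallyEq {F G : Type*} [NormedAddCommGroup F] [NormedSpace ℝ F]
    [HasContDiffBump F] [NormedAddCommGroup G] [NormedSpace ℝ G]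
    {n : ℕ} {f : F → G} {y : F} (hf : ContDiffAt ℝ n f y) :
    ∃ g : F → G, ContDiff ℝ n g ∧ g =ᶠ[𝓝 y] f := by
  obtain ⟨R, hR, hball⟩ := Metric.eventually_nhds_iff_ball.1 (hf.eventually (by simp))
  let χ : ContDiffBump y := ⟨R / 4, R / 2, by positivity, by linarith⟩
  refine ⟨fun z => χ z • f z, contDiff_iff_contDiffAt.2 fun z => ?_,
    χ.eventuallyEq_one.mono fun z hz => by simp [hz]⟩
  by_cases hz : z ∈ Metric.ball y R
  · exact χ.contDiff.contDiffAt.smul (hball z hz)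
  · have hzχ : z ∉ tsupport χ := fun hmem =>
      hz (Metric.closedBall_subset_ball (half_lt_self hR) (χ.tsupport_eq ▸ hmem))
    refine (contDiffAt_const (c := (0 : G))).congr_of_eventuallyEq ?_
    filter_upwards [notMem_tsupport_iff_eventuallyEq.1 hzχ] with w hw
    simp [hw]

theorem exists_strictMonoOn_of_fderiv_pos {F : Type*} [NormedAddCommGroup F] [NormedSpace ℝ F]
    {h : F × ℝ → ℝ} (hh : ContDiff ℝ 1 h) {u : F × ℝ} (hpos : 0 < fderiv ℝ h u (0, 1)) :
    ∃ δ > 0, ∀ y ∈ Metric.ball u.1 δ,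
      StrictMonoOn (fun s => h (y, s)) (Metric.ball u.2 δ) := by
  have hcont := (hh.continuous_fderiv one_ne_zero).clm_apply (continuous_const (y := ((0 : F), 1)))
  obtain ⟨δ, hδ, hbox⟩ :=
    Metric.eventually_nhds_iff_ball.1 (hcont.continuousAt.eventually_const_lt hpos)
  refine ⟨δ, hδ, fun y hy => ?_⟩
  have hderiv : ∀ s, HasDerivAt (fun s => h (y, s)) (fderiv ℝ h (y, s) (0, 1)) s := fun s =>
    (hh.differentiable one_ne_zero (y, s)).hasFDerivAt.comp_hasDerivAt s
      ((hasDerivAt_const s y).prodMk (hasDerivAt_id s))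
  refine strictMonoOn_of_deriv_pos (convex_ball _ _)
    (fun s _ => (hderiv s).continuousAt.continuousWithinAt) fun s hs => ?_
  rw [(hderiv s).deriv]
  exact hbox _ (ball_prod_same u.1 u.2 δ ▸ ⟨hy, interior_subset hs⟩)

theorem exists_eventually_neg_iff_snd_lt {F : Type*} [NormedAddCommGroup F] [NormedSpace ℝ F]
    [CompleteSpace F] {n : WithTop ℕ∞} (hn : n ≠ 0) {h : F × ℝ → ℝ} (hh : ContDiff ℝ n h)
    {u : F × ℝ} (hu : h u = 0) (hpos : 0 < fderiv ℝ h u (0, 1)) :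
    ∃ ψ : F → ℝ, ContDiffAt ℝ n ψ u.1 ∧ ∀ᶠ p in 𝓝 u, h p < 0 ↔ p.2 < ψ p.1 := by
  have hinv : (fderiv ℝ h u ∘L .inr ℝ F ℝ).IsInvertible :=
    ⟨ContinuousLinearEquiv.unitsEquivAut ℝ (Units.mk0 _ hpos.ne'), by ext; simp⟩
  have hhu : ContDiffAt ℝ n h u := hh.contDiffAt
  have hψ := hhu.contDiffAt_implicitFunction hn hinv
  set ψ := hhu.implicitFunction hn hinv
  refine ⟨ψ, hψ, ?_⟩
  have hψu : ψ u.1 = u.2 := hhu.implicitFunction_apply_self hn hinv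
  obtain ⟨δ, hδ, hmono⟩ := exists_strictMonoOn_of_fderiv_pos
    (hh.of_le (ENat.one_le_iff_ne_zero_withTop.2 hn)) hpos
  have hgraph : ∀ᶠ y in 𝓝 u.1, h (y, ψ y) = 0 ∧ ψ y ∈ Metric.ball u.2 δ :=
    (hhu.eventually_apply_implicitFunction hn hinv |>.mono fun y hy => hy.trans hu).and
      (hψ.continuousAt.eventually_mem (hψu.symm ▸ Metric.ball_mem_nhds _ hδ))
  filter_upwards [continuous_fst.continuousAt.eventually hgraph,
    Metric.ball_mem_nhds u hδ] with p ⟨hp₀, hpψ⟩ hp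
  rw [← ball_prod_same] at hp
  rw [← (hmono p.1 hp.1).lt_iff_lt hp.2 hpψ]
  simp only [hp₀]

section GraphChart

variable {F E : Type*} [NormedAddCommGroup F] [InnerProductSpace ℝ F] [NormedAddCommGroup E]
  [InnerProductSpace ℝ E]

/-- In the open set `U`, the set `D` lies strictly below the graph of the `C²` function `ψ`, in the
orthonormal coordinates given by `T`. -/
structure IsGraphChart (D : Set E) (T : WithLp 2 (F × ℝ) ≃ₗᵢ[ℝ] E) (ψ : F → ℝ) (U : Set E) :
    Prop where
  contDiff : ContDiff ℝ 2 ψ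
  isOpen : IsOpen U
  mem_iff : ∀ x ∈ U, x ∈ D ↔ (T.symm x).snd < ψ (T.symm x).fst

variable {D : Set E} {T : WithLp 2 (F × ℝ) ≃ₗᵢ[ℝ] E} {ψ : F → ℝ} {U : Set E}

theorem frontier_subgraph (hψ : Continuous ψ) :
    frontier {x | (T.symm x).snd < ψ (T.symm x).fst} =
      {x | (T.symm x).snd = ψ (T.symm x).fst} := by
  have hcoord : Continuous fun x => (T.symm x).ofLp :=
    (WithLp.prod_continuous_ofLp 2 F ℝ).comp T.symm.continuous
  have hfst : Continuous fun x => ψ (T.symm x).fst := hψ.comp (continuous_fst.comp hcoord)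
  have hsnd : Continuous fun x => (T.symm x).snd := continuous_snd.comp hcoord
  refine (frontier_lt_subset_eq hsnd hfst).antisymm fun x hx => ?_
  rw [(isOpen_lt hsnd hfst).frontier_eq]
  refine ⟨?_, fun hlt : (T.symm x).snd < ψ (T.symm x).fst => hlt.ne hx⟩
  have hline : Continuous fun s : ℝ => T (WithLp.toLp 2 ((T.symm x).fst, s)) :=
    T.continuous.comp ((WithLp.prod_continuous_toLp 2 F ℝ).comp (by fun_prop))
  have hlim : Tendsto (fun s : ℝ => T (WithLp.toLp 2 ((T.symm x).fst, s)))
      (𝓝[<] (T.symm x).snd) (𝓝 x) := by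
    convert! (hline.tendsto (T.symm x).snd).mono_left nhdsWithin_le_nhds
    exact (T.apply_symm_apply x).symm
  refine mem_closure_of_tendsto hlim ?_
  filter_upwards [self_mem_nhdsWithin] with s hs
  simpa using (show s < (T.symm x).snd from hs).trans_eq hx

theorem IsGraphChart.mem_frontier_iff (h : IsGraphChart D T ψ U) {x : E} (hx : x ∈ U) :
    x ∈ frontier D ↔ (T.symm x).snd = ψ (T.symm x).fst := by
  have hinter : D ∩ U = {x | (T.symm x).snd < ψ (T.symm x).fst} ∩ U :=
    Set.ext fun z => and_congr_left (h.mem_iff z)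
  have hfrontier : frontier D ∩ U = {x | (T.symm x).snd = ψ (T.symm x).fst} ∩ U := by
    rw [← frontier_inter_open_inter h.isOpen, hinter, frontier_inter_open_inter h.isOpen,
      frontier_subgraph h.contDiff.continuous]
  simpa [hx] using Set.ext_iff.1 hfrontier x

theorem IsGraphChart.mem_frontier_iff_mem_range (h : IsGraphChart D T ψ U) {x : E} (hx : x ∈ U) :
    x ∈ frontier D ↔ x ∈ Set.range (graphMap T ψ) := by
  rw [h.mem_frontier_iff hx]
  constructor
  · exact fun hgraph => ⟨(T.symm x).fst, by rw [graphMap, ← hgraph]; exact T.apply_symm_apply x⟩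
  · rintro ⟨y, rfl⟩
    simp [graphMap]

theorem hasGradientAt_snd_sub_fst {y : F} [FiniteDimensional ℝ F] [CompleteSpace E]
    (hψ : DifferentiableAt ℝ ψ y) :
    HasGradientAt (fun x => (T.symm x).snd - ψ (T.symm x).fst)
      (T (WithLp.toLp 2 (-gradient ψ y, 1))) (graphMap T ψ y) := by
  let S : E →L[ℝ] F × ℝ := (WithLp.prodContinuousLinearEquiv 2 ℝ F ℝ : _ →L[ℝ] F × ℝ) ∘L
    (T.symm : E →L[ℝ] WithLp 2 (F × ℝ))
  have hψ' : HasFDerivAt ψ (fderiv ℝ ψ y) (S (graphMap T ψ y)).1 := by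
    simpa [S, graphMap] using hψ.hasFDerivAt
  have hderiv := (hasFDerivAt_snd.comp _ S.hasFDerivAt).sub
    (hψ'.comp (graphMap T ψ y) (hasFDerivAt_fst.comp _ S.hasFDerivAt))
  refine hasGradientAt_iff_hasFDerivAt.2 (hderiv.congr_fderiv (ContinuousLinearMap.ext fun v => ?_))
  obtain ⟨p, rfl⟩ := T.surjective v
  rw [InnerProductSpace.toDual_apply_apply, T.inner_map_map, WithLp.prod_inner_apply,
    inner_neg_left, inner_gradient_left]
  simp [S]
  ring

end GraphChart

section OuterNormal

variable {Ω : Set Vec3} {F : Type*} [NormedAddCommGroup F] [InnerProductSpace ℝ F]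
  [FiniteDimensional ℝ F] {T : WithLp 2 (F × ℝ) ≃ₗᵢ[ℝ] Vec3} {ψ : F → ℝ} {U : Set Vec3}

theorem exists_isGraphChart (hdim : Module.finrank ℝ F = 2) (hΩ : IsOpen Ω)
    (hΩ2 : HasC2Boundary Ω) {x : Vec3} (hx : x ∈ frontier Ω) :
    ∃ (T : WithLp 2 (F × ℝ) ≃ₗᵢ[ℝ] Vec3) (ψ : F → ℝ) (U : Set Vec3),
      x ∈ U ∧ IsGraphChart Ω T ψ U := by
  obtain ⟨ρ, hρ⟩ := hΩ2 x hx
  obtain ⟨T, hT⟩ := exists_linearIsometryEquiv_prod (F := F) (E := Vec3) (by simp [hdim])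
    (norm_smul_inv_norm (𝕜 := ℝ) hρ.2.1)
  let S : F × ℝ →L[ℝ] Vec3 := (T : WithLp 2 (F × ℝ) →L[ℝ] Vec3) ∘L
    ((WithLp.prodContinuousLinearEquiv 2 ℝ F ℝ).symm : F × ℝ →L[ℝ] WithLp 2 (F × ℝ))
  let π : Vec3 → F × ℝ := fun z => (T.symm z).ofLp
  have hπ : Continuous π := (WithLp.prod_continuous_ofLp 2 F ℝ).comp T.symm.continuous
  have hSπ : ∀ z, S (π z) = z := T.apply_symm_apply
  have hzero : ρ x = 0 := eq_zero_of_mem_frontier hΩ hx hρ.1.continuous.continuousAt hρ.2.2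
  have hpos : 0 < fderiv ℝ (ρ ∘ S) (π x) (0, 1) := by
    rw [((hρ.differentiableAt _).hasFDerivAt.comp _ S.hasFDerivAt).fderiv, hSπ]
    change 0 < fderiv ℝ ρ x (T (WithLp.toLp 2 (0, 1)))
    rw [hT, ← inner_gradient_left, real_inner_smul_right, real_inner_self_eq_norm_sq]
    have := norm_pos_iff.2 hρ.2.1
    positivity
  obtain ⟨ψ₀, hψ₀, hsub⟩ := exists_eventually_neg_iff_snd_lt two_ne_zero
    (hρ.1.comp S.contDiff) (by simp [hSπ, hzero]) hpos
  obtain ⟨ψ, hψ, hψeq⟩ := exists_contDiff_eventuallyEq (n := 2) hψ₀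
  have hmem : ∀ᶠ z in 𝓝 x, z ∈ Ω ↔ (T.symm z).snd < ψ (T.symm z).fst := by
    filter_upwards [hρ.2.2, hπ.continuousAt.eventually hsub,
      (continuous_fst.comp hπ).continuousAt.eventually hψeq] with z hz hzsub hzψ
    rw [Function.comp_apply, hSπ, ← show ψ (π z).1 = ψ₀ (π z).1 from hzψ] at hzsub
    exact hz.trans hzsub
  obtain ⟨U, hUmem, hU, hxU⟩ := mem_nhds_iff.1 hmem
  exact ⟨T, ψ, U, hxU, hψ, hU, fun z hz => hUmem hz⟩

theorem IsGraphChart.outerNormal_graphMap (hΩ : IsOpen Ω) (h : IsGraphChart Ω T ψ U) {y : F}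
    (hy : graphMap T ψ y ∈ U) :
    areaDensity ψ y • outerNormal Ω (graphMap T ψ y) = T (WithLp.toLp 2 (-gradient ψ y, 1)) := by
  have hfrontier := (h.mem_frontier_iff_mem_range hy).2 (Set.mem_range_self y)
  have hgrad := (hasGradientAt_snd_sub_fst (T := T)
    (h.contDiff.differentiable two_ne_zero y)).gradient
  set ρ : Vec3 → ℝ := fun z => (T.symm z).snd - ψ (T.symm z).fst
  have hρ : ContDiff ℝ 2 ρ := by
    have hπ : ContDiff ℝ 2 fun z => (T.symm z).ofLp := WithLp.contDiff_ofLp.comp T.symm.contDiff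
    exact (contDiff_snd.comp hπ).sub (h.contDiff.comp (contDiff_fst.comp hπ))
  have hnorm : ‖gradient ρ (graphMap T ψ y)‖ = areaDensity ψ y := by
    rw [hgrad, T.norm_map, areaDensity, ← Real.sqrt_sq (norm_nonneg (WithLp.toLp 2 _)),
      WithLp.prod_norm_sq_eq_of_L2]
    simp [add_comm]
  have hJ : areaDensity ψ y ≠ 0 := (one_pos.trans_le (one_le_areaDensity ψ y)).ne'
  have hdef : IsDefiningFunctionAt Ω (graphMap T ψ y) ρ := by
    refine ⟨hρ, norm_ne_zero_iff.1 (hnorm ▸ hJ), ?_⟩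
    filter_upwards [h.isOpen.mem_nhds hy] with z hz
    rw [h.mem_iff z hz, sub_neg]
  rw [outerNormal_eq hΩ hfrontier hdef, hnorm, smul_inv_smul₀ hJ, hgrad]

end OuterNormal

/-! ### The surface measure -/

section Surf

variable {Ω : Set Vec3}

section Chart

variable {F : Type*} [NormedAddCommGroup F] [InnerProductSpace ℝ F] [FiniteDimensional ℝ F]
  [MeasurableSpace F] [BorelSpace F] {T : WithLp 2 (F × ℝ) ≃ₗᵢ[ℝ] Vec3} {ψ : F → ℝ}
  {U : Set Vec3}

theorem IsGraphChart.surf_restrict (h : IsGraphChart Ω T ψ U) :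
    (surf Ω).restrict U =
      ((volume.withDensity fun y => .ofReal (areaDensity ψ y)).map (graphMap T ψ)).restrict U := by
  have hdim : Module.finrank ℝ F = 2 := by
    have hT := T.toLinearEquiv.finrank_eq
    rw [(WithLp.linearEquiv 2 ℝ (F × ℝ)).finrank_eq] at hT
    simpa using hT
  rw [map_graphMap (h.contDiff.of_le one_le_two), hdim, surf,
    Measure.restrict_restrict h.isOpen.measurableSet,
    Measure.restrict_restrict h.isOpen.measurableSet]
  congr 1
  exact Set.ext fun x => and_congr_right h.mem_frontier_iff_mem_range

theorem IsGraphChart.surf_apply (h : IsGraphChart Ω T ψ U) {A : Set Vec3} (hA : MeasurableSet A) :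
    surf Ω (A ∩ U) = ∫⁻ y in graphMap T ψ ⁻¹' (A ∩ U), .ofReal (areaDensity ψ y) := by
  have hemb := measurableEmbedding_graphMap (T := T) h.contDiff.continuous
  rw [← Measure.restrict_apply hA, h.surf_restrict, Measure.restrict_apply hA, hemb.map_apply,
    withDensity_apply _ (hemb.measurable (hA.inter h.isOpen.measurableSet))]

end Chart

theorem memLp_restrict_of_continuousOn_isCompact {X : Type*} [TopologicalSpace X]
    [T2Space X] [MeasurableSpace X] [OpensMeasurableSpace X] {μ : Measure X}
    [IsFiniteMeasureOnCompacts μ] {K : Set X} (hK : IsCompact K) {f : X → ℝ}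
    (hf : ContinuousOn f K) (p : ℝ≥0∞) : MemLp f p (μ.restrict K) := by
  have : IsFiniteMeasure (μ.restrict K) := isFiniteMeasure_restrict.2 hK.measure_lt_top.ne
  obtain ⟨C, hC⟩ := hK.exists_bound_of_continuousOn hf
  exact MemLp.of_bound (hf.aestronglyMeasurable hK.measurableSet) C
    (ae_restrict_of_forall_mem hK.measurableSet hC)

theorem surf_restrict_frontier (Ω : Set Vec3) : (surf Ω).restrict (frontier Ω) = surf Ω := by
  rw [surf, Measure.restrict_restrict isClosed_frontier.measurableSet, Set.inter_self]

theorem ae_surf_mem_frontier (Ω : Set Vec3) : ∀ᵐ x ∂surf Ω, x ∈ frontier Ω :=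
  ae_restrict_mem isClosed_frontier.measurableSet

theorem isCompact_frontier (hΩb : Bornology.IsBounded Ω) : IsCompact (frontier Ω) :=
  hΩb.isCompact_closure.of_isClosed_subset isClosed_frontier frontier_subset_closure

theorem IsGraphChart.exists_mem_nhds_surf_lt_top {F : Type*} [NormedAddCommGroup F]
    [InnerProductSpace ℝ F] [FiniteDimensional ℝ F] [MeasurableSpace F] [BorelSpace F]
    {T : WithLp 2 (F × ℝ) ≃ₗᵢ[ℝ] Vec3} {ψ : F → ℝ} {U : Set Vec3} (h : IsGraphChart Ω T ψ U)
    {x : Vec3} (hx : x ∈ U) : ∃ V ∈ 𝓝 x, surf Ω V < ∞ := by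
  obtain ⟨V, hV⟩ : ∃ V, V = (fun z => (T.symm z).fst) ⁻¹' Metric.ball (T.symm x).fst 1 := ⟨_, rfl⟩
  have hVopen : IsOpen V := hV ▸ Metric.isOpen_ball.preimage
    (continuous_fst.comp ((WithLp.prod_continuous_ofLp 2 F ℝ).comp T.symm.continuous))
  have hxV : x ∈ V := hV ▸ Metric.mem_ball_self one_pos
  have hsubset : graphMap T ψ ⁻¹' (V ∩ U) ⊆ Metric.closedBall (T.symm x).fst 1 := fun y hy =>
    Metric.ball_subset_closedBall (by simpa [hV, graphMap] using hy.1)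
  refine ⟨V ∩ U, (hVopen.inter h.isOpen).mem_nhds ⟨hxV, hx⟩, ?_⟩
  rw [h.surf_apply hVopen.measurableSet]
  exact (lintegral_mono_set hsubset).trans_lt
    ((continuous_areaDensity (h.contDiff.of_le one_le_two)).continuousOn.integrableOn_compact
      (isCompact_closedBall _ _)).lintegral_lt_top

theorem isFiniteMeasure_surf (hΩ : IsOpen Ω) (hΩb : Bornology.IsBounded Ω)
    (hΩ2 : HasC2Boundary Ω) : IsFiniteMeasure (surf Ω) := by
  constructor
  rw [← surf_restrict_frontier, Measure.restrict_apply_univ]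
  refine (isCompact_frontier hΩb).measure_lt_top_of_nhdsWithin fun x hx => ?_
  obtain ⟨T, ψ, U, hxU, h⟩ :=
    exists_isGraphChart (F := EuclideanSpace ℝ (Fin 2)) finrank_euclideanSpace_fin hΩ hΩ2 hx
  obtain ⟨V, hV, hlt⟩ := h.exists_mem_nhds_surf_lt_top hxU
  exact ⟨V, mem_nhdsWithin_of_mem_nhds hV, hlt⟩

theorem surf_pos_of_mem_nhds (hΩ : IsOpen Ω) (hΩ2 : HasC2Boundary Ω) {x : Vec3}
    (hx : x ∈ frontier Ω) {V : Set Vec3} (hV : V ∈ 𝓝 x) : 0 < surf Ω V := by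
  obtain ⟨T, ψ, U, hxU, h⟩ :=
    exists_isGraphChart (F := EuclideanSpace ℝ (Fin 2)) finrank_euclideanSpace_fin hΩ hΩ2 hx
  have hgraph : Continuous (graphMap T ψ) := (contDiff_graphMap h.contDiff).continuous
  have hpreimage : IsOpen (graphMap T ψ ⁻¹' (interior V ∩ U)) :=
    (isOpen_interior.inter h.isOpen).preimage hgraph
  obtain ⟨y, rfl⟩ := (h.mem_frontier_iff_mem_range hxU).1 hx
  calc 0 < volume (graphMap T ψ ⁻¹' (interior V ∩ U)) :=
        hpreimage.measure_pos volume ⟨y, mem_interior_iff_mem_nhds.2 hV, hxU⟩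
    _ ≤ ∫⁻ y in graphMap T ψ ⁻¹' (interior V ∩ U), .ofReal (areaDensity ψ y) := by
        rw [← setLIntegral_one]
        exact lintegral_mono fun y => ENNReal.one_le_ofReal.2 (one_le_areaDensity ψ y)
    _ = surf Ω (interior V ∩ U) := (h.surf_apply measurableSet_interior).symm
    _ ≤ surf Ω V := measure_mono (Set.inter_subset_left.trans interior_subset)

theorem memLp_surf_of_continuousOn (hΩ : IsOpen Ω) (hΩb : Bornology.IsBounded Ω)
    (hΩ2 : HasC2Boundary Ω) {f : Vec3 → ℝ} (hf : ContinuousOn f (frontier Ω)) (p : ℝ≥0∞) :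
    MemLp f p (surf Ω) := by
  have := isFiniteMeasure_surf hΩ hΩb hΩ2
  rw [← surf_restrict_frontier]
  exact memLp_restrict_of_continuousOn_isCompact (isCompact_frontier hΩb) hf p

end Surf

/-! ### The divergence theorem -/

theorem integral_fderiv_eq_zero {E : Type*} [NormedAddCommGroup E] [NormedSpace ℝ E]
    [FiniteDimensional ℝ E] [MeasurableSpace E] [BorelSpace E] (μ : Measure E) [μ.IsAddHaarMeasure]
    {f : E → ℝ} (hf : ContDiff ℝ 1 f) (hfc : HasCompactSupport f) (v : E) :
    ∫ x, fderiv ℝ f x v ∂μ = 0 := by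
  have hint : Integrable (fun x => fderiv ℝ f x v) μ :=
    ((hf.continuous_fderiv one_ne_zero).clm_apply continuous_const).integrable_of_hasCompactSupport
      (hfc.fderiv_apply ℝ v)
  simpa using integral_mul_fderiv_eq_neg_fderiv_mul_of_integrable (μ := μ)
    (f := fun _ => (1 : ℝ)) (g := f) (v := v) (by simp) (by simpa using hint)
    (by simpa using hf.continuous.integrable_of_hasCompactSupport hfc)
    (fun x _ => differentiableAt_const _) (fun x _ => hf.differentiable one_ne_zero x)

section Slices

variable {X Y Z : Type*} [TopologicalSpace X] [TopologicalSpace Y] [Zero Z] {f : X × Y → Z}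

theorem hasCompactSupport_comp_prodMk [T1Space X] (hf : HasCompactSupport f) (x : X) :
    HasCompactSupport fun y => f (x, y) :=
  hf.comp_isClosedEmbedding
    ⟨isEmbedding_prodMkRight x, (isClosedMap_prodMk_left x).isClosed_range⟩

theorem hasCompactSupport_comp_prodMk_swap [T1Space Y] (hf : HasCompactSupport f) (y : Y) :
    HasCompactSupport fun x => f (x, y) :=
  hf.comp_isClosedEmbedding ⟨isEmbedding_prodMkLeft y, (isClosedMap_prodMk_right y).isClosed_range⟩

end Slices

section Subgraph

variable {F : Type*} [NormedAddCommGroup F] [NormedSpace ℝ F]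

theorem integral_Iic_fderiv_snd {f : F × ℝ → ℝ} (hf : ContDiff ℝ 1 f) (hfc : HasCompactSupport f)
    (y : F) (b : ℝ) : ∫ t in Set.Iic b, fderiv ℝ f (y, t) (0, 1) = f (y, b) := by
  have hslice : ∀ t, deriv (fun t => f (y, t)) t = fderiv ℝ f (y, t) (0, 1) := fun t =>
    ((hf.differentiable one_ne_zero (y, t)).hasFDerivAt.comp_hasDerivAt t
      ((hasDerivAt_const t y).prodMk (hasDerivAt_id t))).deriv
  simp only [← hslice]
  exact (hasCompactSupport_comp_prodMk hfc y).integral_Iic_deriv_eq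
    (hf.comp (contDiff_const.prodMk contDiff_id)) b

/-- Vertical translation by a continuous function, which maps the lower half space onto the
subgraph of the function. -/
def shear {ψ : F → ℝ} (hψ : Continuous ψ) : F × ℝ ≃ₜ F × ℝ where
  toFun p := (p.1, p.2 + ψ p.1)
  invFun p := (p.1, p.2 - ψ p.1)
  left_inv p := by simp
  right_inv p := by simp
  continuous_toFun := by fun_prop
  continuous_invFun := by fun_prop

theorem fderiv_comp_shear {ψ : F → ℝ} (hψ : ContDiff ℝ 1 ψ) {f : F × ℝ → ℝ}
    (hf : ContDiff ℝ 1 f) (y w : F) (t s : ℝ) :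
    fderiv ℝ (f ∘ shear hψ.continuous) (y, t) (w, s - fderiv ℝ ψ y w) =
      fderiv ℝ f (y, t + ψ y) (w, s) := by
  have hshear : HasFDerivAt (shear hψ.continuous)
      ((ContinuousLinearMap.fst ℝ F ℝ).prod (ContinuousLinearMap.snd ℝ F ℝ +
        (fderiv ℝ ψ y) ∘L ContinuousLinearMap.fst ℝ F ℝ)) (y, t) :=
    hasFDerivAt_fst.prodMk (hasFDerivAt_snd.add
      (HasFDerivAt.comp (y, t) (hψ.differentiable one_ne_zero y).hasFDerivAt hasFDerivAt_fst))
  rw [((hf.differentiable one_ne_zero (y, t + ψ y)).hasFDerivAt.comp (y, t) hshear).fderiv]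
  simp

variable [FiniteDimensional ℝ F] [MeasurableSpace F] [BorelSpace F]

theorem integral_fderiv_fst_eq_zero (μ : Measure F) [μ.IsAddHaarMeasure] {f : F × ℝ → ℝ}
    (hf : ContDiff ℝ 1 f) (hfc : HasCompactSupport f) (w : F) (t : ℝ) :
    ∫ y, fderiv ℝ f (y, t) (w, 0) ∂μ = 0 := by
  have hslice : ∀ y, fderiv ℝ (fun y => f (y, t)) y w = fderiv ℝ f (y, t) (w, 0) := fun y => by
    have hcomp : HasFDerivAt (fun y => f (y, t))
        (fderiv ℝ f (y, t) ∘L ContinuousLinearMap.inl ℝ F ℝ) y :=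
      HasFDerivAt.comp (f := fun y => (y, t)) y
        (hf.differentiable one_ne_zero (y, t)).hasFDerivAt (hasFDerivAt_prodMk_left y t)
    exact DFunLike.congr_fun hcomp.fderiv w
  simp only [← hslice]
  exact integral_fderiv_eq_zero μ (hf.comp (contDiff_id.prodMk contDiff_const))
    (hasCompactSupport_comp_prodMk_swap hfc t) w

theorem integral_halfSpace_fderiv (μ : Measure F) [μ.IsAddHaarMeasure] {f : F × ℝ → ℝ}
    (hf : ContDiff ℝ 1 f) (hfc : HasCompactSupport f) (w : F) {s : F → ℝ} (hs : Continuous s) :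
    ∫ y, (∫ t in Set.Iic 0, fderiv ℝ f (y, t) (w, s y)) ∂μ = ∫ y, s y * f (y, 0) ∂μ := by
  have hcont : ∀ u, Continuous fun p => fderiv ℝ f p u := fun u =>
    (hf.continuous_fderiv one_ne_zero).clm_apply continuous_const
  have hslice : ∀ u y, IntegrableOn (fun t => fderiv ℝ f (y, t) u) (Set.Iic 0) := fun u y =>
    (((hcont u).comp (Continuous.prodMk_right y)).integrable_of_hasCompactSupport
      (hasCompactSupport_comp_prodMk (hfc.fderiv_apply ℝ u) y)).integrableOn
  have hsplit : ∀ y t, fderiv ℝ f (y, t) (w, s y) =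
      fderiv ℝ f (y, t) (w, 0) + s y * fderiv ℝ f (y, t) (0, 1) := fun y t => by
    rw [← smul_eq_mul, ← map_smul, ← map_add]
    simp
  have hinner : ∀ y, ∫ t in Set.Iic 0, fderiv ℝ f (y, t) (w, s y) =
      (∫ t in Set.Iic 0, fderiv ℝ f (y, t) (w, 0)) + s y * f (y, 0) := fun y => by
    simp only [hsplit]
    rw [integral_add (hslice _ y) ((hslice _ y).const_mul _), integral_const_mul,
      integral_Iic_fderiv_snd hf hfc]
  have hintegrable : Integrable (fun p => fderiv ℝ f p (w, 0))
      (μ.prod (volume.restrict (Set.Iic 0))) :=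
    (hcont _).integrable_of_hasCompactSupport (hfc.fderiv_apply ℝ _)
  have hboundary : Integrable (fun y => s y * f (y, 0)) μ :=
    (hs.mul (hf.continuous.comp (Continuous.prodMk_left 0))).integrable_of_hasCompactSupport
      (hasCompactSupport_comp_prodMk_swap hfc 0).mul_left
  simp only [hinner]
  rw [integral_add hintegrable.integral_prod_left hboundary, integral_integral_swap hintegrable]
  simp only [integral_fderiv_fst_eq_zero μ hf hfc, integral_zero, zero_add]

theorem integral_subgraph_fderiv (μ : Measure F) [μ.IsAddHaarMeasure] {ψ : F → ℝ}
    (hψ : ContDiff ℝ 1 ψ) {f : F × ℝ → ℝ} (hf : ContDiff ℝ 1 f) (hfc : HasCompactSupport f)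
    (w : F) (s : ℝ) :
    ∫ y, (∫ t in Set.Iic (ψ y), fderiv ℝ f (y, t) (w, s)) ∂μ =
      ∫ y, (s - fderiv ℝ ψ y w) * f (y, ψ y) ∂μ := by
  have htranslate : ∀ y, ∫ t in Set.Iic (ψ y), fderiv ℝ f (y, t) (w, s) =
      ∫ t in Set.Iic 0, fderiv ℝ f (y, t + ψ y) (w, s) := fun y => by
    rw [← (measurePreserving_add_right volume (ψ y)).setIntegral_preimage_emb
      (measurableEmbedding_addRight (ψ y)), Set.preimage_add_const_Iic, sub_self]
  have hshear : ContDiff ℝ 1 (f ∘ shear hψ.continuous) :=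
    hf.comp (contDiff_fst.prodMk (contDiff_snd.add (hψ.comp contDiff_fst)))
  have hslope : Continuous fun y => s - fderiv ℝ ψ y w :=
    continuous_const.sub ((hψ.continuous_fderiv one_ne_zero).clm_apply continuous_const)
  simp only [htranslate, ← fderiv_comp_shear hψ hf]
  rw [integral_halfSpace_fderiv μ hshear (hfc.comp_homeomorph _) w hslope]
  simp [shear]

end Subgraph

section Chart

variable {F : Type*} [NormedAddCommGroup F] [InnerProductSpace ℝ F] [FiniteDimensional ℝ F]

theorem IsGraphChart.areaDensity_mul_inner_outerNormal {Ω : Set Vec3}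
    {T : WithLp 2 (F × ℝ) ≃ₗᵢ[ℝ] Vec3} {ψ : F → ℝ} {U : Set Vec3} (h : IsGraphChart Ω T ψ U)
    (hΩ : IsOpen Ω) {y : F} (hy : graphMap T ψ y ∈ U) (w : F) (s : ℝ) :
    areaDensity ψ y * inner ℝ (outerNormal Ω (graphMap T ψ y)) (T (WithLp.toLp 2 (w, s))) =
      s - fderiv ℝ ψ y w := by
  rw [← real_inner_smul_left, h.outerNormal_graphMap hΩ hy, T.inner_map_map,
    WithLp.prod_inner_apply]
  simp [inner_gradient_left]
  ring

variable [MeasurableSpace F] [BorelSpace F]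

theorem IsGraphChart.setIntegral {E : Type*} [NormedAddCommGroup E] [InnerProductSpace ℝ E]
    [FiniteDimensional ℝ E] [MeasurableSpace E] [BorelSpace E] {D : Set E}
    {T : WithLp 2 (F × ℝ) ≃ₗᵢ[ℝ] E} {ψ : F → ℝ} {U : Set E} (h : IsGraphChart D T ψ U)
    (hD : MeasurableSet D) {f : E → ℝ} (hf : Integrable f) (hfU : ∀ x ∉ U, f x = 0) :
    ∫ x in D, f x = ∫ y, ∫ t in Set.Iic (ψ y), f (T (WithLp.toLp 2 (y, t))) := by
  have hcoord : MeasurePreserving fun p : F × ℝ => T (WithLp.toLp 2 p) :=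
    T.measurePreserving.comp (WithLp.volume_preserving_toLp F ℝ)
  have hemb : MeasurableEmbedding fun p : F × ℝ => T (WithLp.toLp 2 p) :=
    T.toHomeomorph.measurableEmbedding.comp (MeasurableEquiv.toLp 2 (F × ℝ)).measurableEmbedding
  have hsubgraph : MeasurableSet {p : F × ℝ | p.2 < ψ p.1} :=
    (isOpen_lt continuous_snd (h.contDiff.continuous.comp continuous_fst)).measurableSet
  have hindicator : ∀ p : F × ℝ, D.indicator f (T (WithLp.toLp 2 p)) =
      {p : F × ℝ | p.2 < ψ p.1}.indicator (fun p => f (T (WithLp.toLp 2 p))) p := fun p => by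
    by_cases hp : T (WithLp.toLp 2 p) ∈ U
    · simp only [Set.indicator, h.mem_iff _ hp, T.symm_apply_apply, Set.mem_ofPred_eq]
      rfl
    · simp only [Set.indicator, hfU _ hp, ite_self]
  calc ∫ x in D, f x
      = ∫ p : F × ℝ, {p : F × ℝ | p.2 < ψ p.1}.indicator (fun p => f (T (WithLp.toLp 2 p))) p := by
        rw [← integral_indicator hD, ← hcoord.integral_comp hemb]
        simp only [hindicator]
    _ = ∫ y, ∫ t, {p : F × ℝ | p.2 < ψ p.1}.indicator
          (fun p => f (T (WithLp.toLp 2 p))) (y, t) :=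
        integral_prod _ ((hcoord.integrable_comp_of_integrable hf).indicator hsubgraph)
    _ = ∫ y, ∫ t in Set.Iic (ψ y), f (T (WithLp.toLp 2 (y, t))) := by
        refine integral_congr_ae (.of_forall fun y => ?_)
        simp only [integral_Iic_eq_integral_Iio, ← integral_indicator measurableSet_Iio]
        rfl

variable {Ω : Set Vec3} {T : WithLp 2 (F × ℝ) ≃ₗᵢ[ℝ] Vec3} {ψ : F → ℝ} {U : Set Vec3}

theorem IsGraphChart.integral_surf (h : IsGraphChart Ω T ψ U) {f : Vec3 → ℝ}
    (hf : ∀ x ∉ U, f x = 0) :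
    ∫ x, f x ∂surf Ω = ∫ y, areaDensity ψ y * f (graphMap T ψ y) := by
  rw [← setIntegral_eq_integral_of_forall_compl_eq_zero hf, h.surf_restrict,
    setIntegral_eq_integral_of_forall_compl_eq_zero hf,
    (measurableEmbedding_graphMap h.contDiff.continuous).integral_map,
    integral_withDensity_eq_integral_toReal_smul
      (continuous_areaDensity (h.contDiff.of_le one_le_two)).measurable.ennreal_ofReal (by simp)]
  refine integral_congr_ae (.of_forall fun y => ?_)
  simp only [smul_eq_mul, ENNReal.toReal_ofReal (zero_le_one.trans (one_le_areaDensity ψ y))]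

theorem IsGraphChart.integral_fderiv (h : IsGraphChart Ω T ψ U) (hΩ : IsOpen Ω)
    {f : Vec3 → ℝ} (hf : ContDiff ℝ 1 f) (hfc : HasCompactSupport f) (hfU : tsupport f ⊆ U)
    (v : Vec3) :
    ∫ x in Ω, fderiv ℝ f x v = ∫ x, f x * inner ℝ (outerNormal Ω x) v ∂surf Ω := by
  have hf_zero : ∀ x ∉ U, f x = 0 := fun x hx =>
    image_eq_zero_of_notMem_tsupport fun hx' => hx (hfU hx')
  have hfderiv_zero : ∀ x ∉ U, fderiv ℝ f x v = 0 := fun x hx => by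
    rw [fderiv_of_notMem_tsupport ℝ fun hx' => hx (hfU hx'), zero_apply]
  have hfderiv_int : Integrable fun x => fderiv ℝ f x v :=
    ((hf.continuous_fderiv one_ne_zero).clm_apply continuous_const).integrable_of_hasCompactSupport
      (hfc.fderiv_apply ℝ v)
  obtain ⟨⟨w, s⟩, rfl⟩ := (T.surjective.comp (WithLp.toLp_surjective 2)) v
  let Φ : (F × ℝ) ≃L[ℝ] Vec3 :=
    (WithLp.prodContinuousLinearEquiv 2 ℝ F ℝ).symm.trans T.toContinuousLinearEquiv
  calc ∫ x in Ω, fderiv ℝ f x (Φ (w, s))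
      = ∫ y, ∫ t in Set.Iic (ψ y), fderiv ℝ f (Φ (y, t)) (Φ (w, s)) :=
        h.setIntegral hΩ.measurableSet hfderiv_int hfderiv_zero
    _ = ∫ y, ∫ t in Set.Iic (ψ y), fderiv ℝ (f ∘ Φ) (y, t) (w, s) := by
        simp only [Φ.comp_right_fderiv, ContinuousLinearMap.comp_apply,
          ContinuousLinearEquiv.coe_coe]
    _ = ∫ y, (s - fderiv ℝ ψ y w) * f (graphMap T ψ y) :=
        integral_subgraph_fderiv volume (h.contDiff.of_le one_le_two) (hf.comp Φ.contDiff)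
          (hfc.comp_homeomorph Φ.toHomeomorph) w s
    _ = ∫ y, areaDensity ψ y * (f (graphMap T ψ y) *
          inner ℝ (outerNormal Ω (graphMap T ψ y)) (Φ (w, s))) := by
        refine integral_congr_ae (.of_forall fun y => ?_)
        by_cases hy : graphMap T ψ y ∈ U
        · simp only [← h.areaDensity_mul_inner_outerNormal hΩ hy w s]
          exact mul_right_comm _ _ _ |>.trans (mul_assoc _ _ _)
        · simp only [hf_zero _ hy, zero_mul, mul_zero]
    _ = ∫ x, f x * inner ℝ (outerNormal Ω x) (Φ (w, s)) ∂surf Ω :=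
        (h.integral_surf (f := fun x => f x * inner ℝ (outerNormal Ω x) (Φ (w, s)))
          fun x hx => by rw [hf_zero x hx, zero_mul]).symm

end Chart

section Global

variable {Ω : Set Vec3}

theorem integral_fderiv_of_tsupport_subset (hΩ : IsOpen Ω) {f : Vec3 → ℝ} (hf : ContDiff ℝ 1 f)
    (hfc : HasCompactSupport f) (hfΩ : tsupport f ⊆ Ω) (v : Vec3) :
    ∫ x in Ω, fderiv ℝ f x v = ∫ x, f x * inner ℝ (outerNormal Ω x) v ∂surf Ω := by
  have hsurf : ∫ x, f x * inner ℝ (outerNormal Ω x) v ∂surf Ω = 0 := by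
    refine integral_eq_zero_of_ae ?_
    filter_upwards [ae_surf_mem_frontier Ω] with x hx
    have hxΩ : x ∉ tsupport f := fun hx' => (hΩ.frontier_eq ▸ hx).2 (hfΩ hx')
    simp only [image_eq_zero_of_notMem_tsupport hxΩ, zero_mul, Pi.zero_apply]
  rw [hsurf, setIntegral_eq_integral_of_forall_compl_eq_zero, integral_fderiv_eq_zero _ hf hfc]
  intro x hx
  rw [fderiv_of_notMem_tsupport ℝ fun hx' => hx (hfΩ hx'), zero_apply]

theorem exists_nhds_integral_fderiv (hΩ : IsOpen Ω) (hΩ2 : HasC2Boundary Ω) {x : Vec3}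
    (hx : x ∈ closure Ω) (v : Vec3) :
    ∃ U : Set Vec3, IsOpen U ∧ x ∈ U ∧ ∀ f : Vec3 → ℝ, ContDiff ℝ 1 f → HasCompactSupport f →
      tsupport f ⊆ U →
        ∫ x in Ω, fderiv ℝ f x v = ∫ x, f x * inner ℝ (outerNormal Ω x) v ∂surf Ω := by
  by_cases hxΩ : x ∈ Ω
  · exact ⟨Ω, hΩ, hxΩ, fun f hf hfc hfΩ => integral_fderiv_of_tsupport_subset hΩ hf hfc hfΩ v⟩
  · obtain ⟨T, ψ, U, hxU, h⟩ := exists_isGraphChart (F := EuclideanSpace ℝ (Fin 2))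
      finrank_euclideanSpace_fin hΩ hΩ2
      (by rw [hΩ.frontier_eq]; exact ⟨hx, hxΩ⟩)
    exact ⟨U, h.isOpen, hxU, fun f hf hfc hfU => h.integral_fderiv hΩ hf hfc hfU v⟩

theorem exists_finite_partition_of_unity {E : Type*} [NormedAddCommGroup E] [NormedSpace ℝ E]
    [FiniteDimensional ℝ E] {K : Set E} (hK : IsCompact K) {U : K → Set E}
    (hU : ∀ x, IsOpen (U x)) (hxU : ∀ x : K, ↑x ∈ U x) :
    ∃ (t : Finset K) (p : t → E → ℝ),
      (∀ i, ContDiff ℝ 1 (p i) ∧ HasCompactSupport (p i) ∧ tsupport (p i) ⊆ U i) ∧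
      ∀ x ∈ K, ∑ i, p i x = 1 := by
  let V : K → Set E := fun x => U x ∩ Metric.ball x 1
  have hV : ∀ x, IsOpen (V x) := fun x => (hU x).inter Metric.isOpen_ball
  obtain ⟨t, ht⟩ := hK.elim_finite_subcover V hV fun x hx =>
    Set.mem_iUnion.2 ⟨⟨x, hx⟩, hxU ⟨x, hx⟩, Metric.mem_ball_self one_pos⟩
  obtain ⟨p, hp⟩ := SmoothPartitionOfUnity.exists_isSubordinate (modelWithCornersSelf ℝ E)
    hK.isClosed (fun i : t => V i) (fun i => hV i) (by rwa [Set.iUnion_subtype])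
  refine ⟨t, fun i => p i, fun i => ⟨(p i).contMDiff.contDiff.of_le (by exact_mod_cast le_top),
    ?_, (hp i).trans Set.inter_subset_left⟩, fun x hx => ?_⟩
  · exact Metric.isCompact_of_isClosed_isBounded (isClosed_tsupport _)
      (Metric.isBounded_ball.subset ((hp i).trans Set.inter_subset_right))
  · rw [← finsum_eq_sum_of_fintype]
    exact p.sum_eq_one hx

/-- The divergence theorem for the vector field `f v`, with constant `v`. -/
theorem integral_fderiv_eq_integral_surf (hΩ : IsOpen Ω) (hΩb : Bornology.IsBounded Ω)
    (hΩ2 : HasC2Boundary Ω) {f : Vec3 → ℝ} (hf : ContDiff ℝ 1 f) (v : Vec3) :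
    ∫ x in Ω, fderiv ℝ f x v = ∫ x, f x * inner ℝ (outerNormal Ω x) v ∂surf Ω := by
  choose U hU hxU hlocal using fun x : closure Ω => exists_nhds_integral_fderiv hΩ hΩ2 x.2 v
  obtain ⟨t, p, hp, hsum⟩ := exists_finite_partition_of_unity hΩb.isCompact_closure hU hxU
  have hC1 : ∀ i, ContDiff ℝ 1 fun x => p i x * f x := fun i => (hp i).1.mul hf
  have hcompact : ∀ i, HasCompactSupport fun x => p i x * f x := fun i => (hp i).2.1.mul_right
  have hdecomp : ∀ x ∈ closure Ω, f x = ∑ i, p i x * f x := fun x hx => by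
    rw [← Finset.sum_mul, hsum x hx, one_mul]
  have hfderiv : ∀ x ∈ Ω, fderiv ℝ f x v = ∑ i, fderiv ℝ (fun x => p i x * f x) x v := by
    intro x hx
    have hnear : f =ᶠ[𝓝 x] fun y => ∑ i, p i y * f y :=
      eventually_of_mem (hΩ.mem_nhds hx) fun y hy => hdecomp y (subset_closure hy)
    rw [hnear.fderiv_eq, fderiv_fun_sum fun i _ => (hC1 i).differentiable one_ne_zero x, sum_apply]
  calc ∫ x in Ω, fderiv ℝ f x v
      = ∑ i, ∫ x in Ω, fderiv ℝ (fun x => p i x * f x) x v := by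
        rw [setIntegral_congr_fun hΩ.measurableSet hfderiv, integral_finsetSum]
        exact fun i _ => (((hC1 i).continuous_fderiv one_ne_zero).clm_apply
          continuous_const).integrable_of_hasCompactSupport
            ((hcompact i).fderiv_apply ℝ v) |>.integrableOn
    _ = ∑ i, ∫ x, p i x * f x * inner ℝ (outerNormal Ω x) v ∂surf Ω :=
        Finset.sum_congr rfl fun i _ => hlocal i _ (hC1 i) (hcompact i)
          ((tsupport_mul_subset_left).trans (hp i).2.2)
    _ = ∫ x, ∑ i, p i x * f x * inner ℝ (outerNormal Ω x) v ∂surf Ω :=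
        (integral_finsetSum _ fun i _ => memLp_one_iff_integrable.1 <|
          memLp_surf_of_continuousOn hΩ hΩb hΩ2 ((hC1 i).continuous.continuousOn.mul
            ((continuousOn_outerNormal hΩ hΩ2).inner continuousOn_const)) 1).symm
    _ = ∫ x, f x * inner ℝ (outerNormal Ω x) v ∂surf Ω := by
        refine integral_congr_ae ?_
        filter_upwards [ae_surf_mem_frontier Ω] with x hx
        rw [← Finset.sum_mul, ← hdecomp x (frontier_subset_closure hx)]

end Global

/-! ### Weak gradients and traces -/

section PartialDerivatives

theorem contDiff_pderiv {f : Vec3 → ℝ} (hf : ContDiff ℝ 2 f) (k : Fin 3) :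
    ContDiff ℝ 1 (pderiv k f) :=
  (hf.fderiv_right (m := 1) (by norm_num)).clm_apply contDiff_const

theorem continuous_pderiv {f : Vec3 → ℝ} (hf : ContDiff ℝ 1 f) (k : Fin 3) :
    Continuous (pderiv k f) :=
  (hf.continuous_fderiv one_ne_zero).clm_apply continuous_const

theorem pderiv_mul {f g : Vec3 → ℝ} {x : Vec3} (hf : DifferentiableAt ℝ f x)
    (hg : DifferentiableAt ℝ g x) (k : Fin 3) :
    pderiv k (fun y => f y * g y) x = f x * pderiv k g x + pderiv k f x * g x := by
  rw [pderiv, fderiv_fun_mul hf hg]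
  simp [pderiv, mul_comm]

end PartialDerivatives

section WeakGradient

variable {Ω : Set Vec3} {P δP : Vec3 → Mat3} {G G' : Vec3 → Tensor3}

theorem ae_restrict_eq_of_integral_contDiff_mul_eq {E : Type*} [NormedAddCommGroup E]
    [NormedSpace ℝ E] [FiniteDimensional ℝ E] [MeasurableSpace E] [BorelSpace E] {μ : Measure E}
    {U : Set E} (hU : IsOpen U) {f g : E → ℝ} (hf : LocallyIntegrable f (μ.restrict U))
    (hg : LocallyIntegrable g (μ.restrict U))
    (h : ∀ φ : E → ℝ, ContDiff ℝ (⊤ : ℕ∞) φ → HasCompactSupport φ → tsupport φ ⊆ U →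
      ∫ x in U, f x * φ x ∂μ = ∫ x in U, g x * φ x ∂μ) :
    f =ᵐ[μ.restrict U] g := by
  have hdiff : ∀ᵐ x ∂μ, x ∈ U → f x - g x = 0 := by
    refine hU.ae_eq_zero_of_integral_contDiff_smul_eq_zero
      (locallyIntegrableOn_of_locallyIntegrable_restrict (hf.sub hg)) fun φ hφ hφc hφU => ?_
    have hφ_zero : ∀ x ∉ U, φ x • (f x - g x) = 0 := fun x hx => by
      rw [image_eq_zero_of_notMem_tsupport fun hx' => hx (hφU hx'), zero_smul]
    rw [← setIntegral_eq_integral_of_forall_compl_eq_zero hφ_zero]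
    have hfφ := hf.integrable_smul_left_of_hasCompactSupport hφ.continuous hφc
    have hgφ := hg.integrable_smul_left_of_hasCompactSupport hφ.continuous hφc
    simp only [smul_sub]
    rw [integral_sub hfφ hgφ, sub_eq_zero]
    simpa only [smul_eq_mul, mul_comm] using h φ hφ hφc hφU
  rw [Filter.EventuallyEq, ae_restrict_iff' hU.measurableSet]
  filter_upwards [hdiff] with x hx hxU using sub_eq_zero.1 (hx hxU)

theorem HasWeakGrad.ae_eq (hΩ : IsOpen Ω) (h : HasWeakGrad Ω P G) (h' : HasWeakGrad Ω P G') :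
    G =ᵐ[volume.restrict Ω] G' := by
  have hentry : ∀ i j k, ∀ᵐ x ∂volume.restrict Ω, G x i j k = G' x i j k := fun i j k =>
    ae_restrict_eq_of_integral_contDiff_mul_eq hΩ ((h.2.1 i j k).locallyIntegrable one_le_two)
      ((h'.2.1 i j k).locallyIntegrable one_le_two) fun φ hφ hφc hφΩ =>
        neg_injective ((h.2.2 i j k φ hφ hφc hφΩ).symm.trans (h'.2.2 i j k φ hφ hφc hφΩ))
  simp only [← ae_all_iff] at hentry
  filter_upwards [hentry] with x hx
  funext i j k
  exact hx i j k

theorem hasWeakGrad_weakGrad (h : MemH1 Ω P) : HasWeakGrad Ω P (weakGrad Ω P) := by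
  rw [weakGrad, dif_pos h]
  exact h.choose_spec

theorem HasWeakGrad.weakGrad_ae_eq (h : HasWeakGrad Ω P G) (hΩ : IsOpen Ω) :
    weakGrad Ω P =ᵐ[volume.restrict Ω] G :=
  (hasWeakGrad_weakGrad ⟨G, h⟩).ae_eq hΩ h

theorem integral_add_smul_mul {X : Type*} [MeasurableSpace X] {μ : Measure X} {f g φ : X → ℝ}
    (hf : MemLp f 2 μ) (hg : MemLp g 2 μ) (hφ : MemLp φ 2 μ) (t : ℝ) :
    ∫ x, (f x + t * g x) * φ x ∂μ = (∫ x, f x * φ x ∂μ) + t * ∫ x, g x * φ x ∂μ := by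
  have hfφ : Integrable (fun x => f x * φ x) μ := hf.integrable_mul hφ
  have hgφ : Integrable (fun x => g x * φ x) μ := hg.integrable_mul hφ
  simp only [add_mul, mul_assoc]
  rw [integral_add hfφ (hgφ.const_mul t), integral_const_mul]

theorem HasWeakGrad.add_smul (h : HasWeakGrad Ω P G) (h' : HasWeakGrad Ω δP G') (t : ℝ) :
    HasWeakGrad Ω (P + t • δP) (G + t • G') := by
  refine ⟨fun i j => (h.1 i j).add ((h'.1 i j).const_mul t),
    fun i j k => (h.2.1 i j k).add ((h'.2.1 i j k).const_mul t), fun i j k φ hφ hφc hφΩ => ?_⟩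
  have hφ_memLp : MemLp φ 2 (volume.restrict Ω) := hφ.continuous.memLp_of_hasCompactSupport hφc
  have hpderiv_memLp : MemLp (pderiv k φ) 2 (volume.restrict Ω) :=
    (continuous_pderiv (hφ.of_le (by exact_mod_cast le_top)) k).memLp_of_hasCompactSupport
      (hφc.fderiv_apply ℝ _)
  calc ∫ x in Ω, (P x i j + t * δP x i j) * pderiv k φ x
      = (∫ x in Ω, P x i j * pderiv k φ x) + t * ∫ x in Ω, δP x i j * pderiv k φ x :=
        integral_add_smul_mul (h.1 i j) (h'.1 i j) hpderiv_memLp t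
    _ = -((∫ x in Ω, G x i j k * φ x) + t * ∫ x in Ω, G' x i j k * φ x) := by
        rw [h.2.2 i j k φ hφ hφc hφΩ, h'.2.2 i j k φ hφ hφc hφΩ]
        ring
    _ = -∫ x in Ω, (G x i j k + t * G' x i j k) * φ x := by
        rw [integral_add_smul_mul (h.2.1 i j k) (h'.2.1 i j k) hφ_memLp]

theorem memLp_restrict_of_isBounded (hΩb : Bornology.IsBounded Ω) {f : Vec3 → ℝ}
    (hf : Continuous f) (p : ℝ≥0∞) : MemLp f p (volume.restrict Ω) :=
  (memLp_restrict_of_continuousOn_isCompact hΩb.isCompact_closure hf.continuousOn p).mono_measure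
    (Measure.restrict_mono subset_closure le_rfl)

theorem hasWeakGrad_grad (hΩb : Bornology.IsBounded Ω)
    (hP : ∀ i j, ContDiff ℝ 1 fun x => P x i j) : HasWeakGrad Ω P (grad P) := by
  refine ⟨fun i j => memLp_restrict_of_isBounded hΩb (hP i j).continuous 2,
    fun i j k => memLp_restrict_of_isBounded hΩb (continuous_pderiv (hP i j) k) 2,
    fun i j k φ hφ hφc hφΩ => ?_⟩
  have hφ1 : ContDiff ℝ 1 φ := hφ.of_le (by exact_mod_cast le_top)
  have hφ_zero : ∀ x ∉ Ω, φ x = 0 := fun x hx =>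
    image_eq_zero_of_notMem_tsupport fun hx' => hx (hφΩ hx')
  have hpderiv_zero : ∀ x ∉ Ω, pderiv k φ x = 0 := fun x hx => by
    rw [pderiv, fderiv_of_notMem_tsupport ℝ fun hx' => hx (hφΩ hx'), zero_apply]
  rw [setIntegral_eq_integral_of_forall_compl_eq_zero fun x hx => by
      rw [hpderiv_zero x hx, mul_zero],
    setIntegral_eq_integral_of_forall_compl_eq_zero fun x hx => by rw [hφ_zero x hx, mul_zero]]
  exact integral_mul_fderiv_eq_neg_fderiv_mul_of_integrable
    (((continuous_pderiv (hP i j) k).mul hφ.continuous).integrable_of_hasCompactSupport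
      hφc.mul_left)
    (((hP i j).continuous.mul (continuous_pderiv hφ1 k)).integrable_of_hasCompactSupport
      (hφc.fderiv_apply ℝ _).mul_left)
    (((hP i j).continuous.mul hφ.continuous).integrable_of_hasCompactSupport hφc.mul_left)
    (fun x _ => (hP i j).differentiable one_ne_zero x)
    (fun x _ => hφ1.differentiable one_ne_zero x)

theorem isTrace_of_contDiff (hΩ : IsOpen Ω) (hΩb : Bornology.IsBounded Ω)
    (hΩ2 : HasC2Boundary Ω) (hP : ∀ i j, ContDiff ℝ 1 fun x => P x i j) : IsTrace Ω P P := by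
  have hgrad := hasWeakGrad_grad hΩb hP
  refine ⟨⟨_, hgrad⟩, fun i j =>
    memLp_surf_of_continuousOn hΩ hΩb hΩ2 (hP i j).continuous.continuousOn 2,
    fun _ => P, fun _ => hP, by simp, fun i j k => ?_, by simp⟩
  have hzero : (fun x => grad P x i j k - weakGrad Ω P x i j k) =ᵐ[volume.restrict Ω] 0 := by
    filter_upwards [hgrad.weakGrad_ae_eq hΩ] with x hx
    simp only [hx, sub_self, Pi.zero_apply]
  simp only [eLpNorm_congr_ae hzero, eLpNorm_zero, tendsto_const_nhds]

end WeakGradient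

/-! ### Green's formula -/

section Green

theorem tendsto_integral_mul_of_tendsto_eLpNorm {X : Type*} [MeasurableSpace X] {μ : Measure X}
    {a q : X → ℝ} {Q : ℕ → X → ℝ} (ha : MemLp a 2 μ) (hq : MemLp q 2 μ) (hQ : ∀ n, MemLp (Q n) 2 μ)
    (h : Tendsto (fun n => eLpNorm (fun x => Q n x - q x) 2 μ) atTop (𝓝 0)) :
    Tendsto (fun n => ∫ x, a x * Q n x ∂μ) atTop (𝓝 (∫ x, a x * q x ∂μ)) := by
  refine tendsto_integral_of_L1' _ (ha.integrable_mul hq).aestronglyMeasurable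
    (Eventually.of_forall fun n => ha.integrable_mul (hQ n)) ?_
  have hlim : Tendsto (fun n => eLpNorm a 2 μ * eLpNorm (fun x => Q n x - q x) 2 μ) atTop
      (𝓝 0) := by
    simpa using ENNReal.Tendsto.const_mul h (Or.inr ha.eLpNorm_lt_top.ne)
  refine tendsto_of_tendsto_of_tendsto_of_le_of_le tendsto_const_nhds hlim (fun _ => zero_le)
    fun n => ?_
  have hholder := eLpNorm_smul_le_mul_eLpNorm (p := 2) (q := 2) (r := 1)
    ((hQ n).sub hq).aestronglyMeasurable ha.aestronglyMeasurable
  refine le_of_eq_of_le (congrArg (eLpNorm · 1 μ) (funext fun x => ?_)) hholder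
  simp [mul_sub]

variable {Ω : Set Vec3} {P g : Vec3 → Mat3}

theorem continuousOn_outerNormal_apply (hΩ : IsOpen Ω) (hΩ2 : HasC2Boundary Ω) (k : Fin 3) :
    ContinuousOn (fun x => outerNormal Ω x k) (frontier Ω) :=
  (EuclideanSpace.proj (𝕜 := ℝ) k).continuous.comp_continuousOn (continuousOn_outerNormal hΩ hΩ2)

theorem integral_mul_pderiv (hΩ : IsOpen Ω) (hΩb : Bornology.IsBounded Ω)
    (hΩ2 : HasC2Boundary Ω) {a u : Vec3 → ℝ} (ha : ContDiff ℝ 1 a) (hu : ContDiff ℝ 1 u)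
    (k : Fin 3) :
    ∫ x in Ω, a x * pderiv k u x =
      (∫ x, a x * outerNormal Ω x k * u x ∂surf Ω) - ∫ x in Ω, pderiv k a x * u x := by
  have hint : ∀ {f g : Vec3 → ℝ}, Continuous f → Continuous g →
      IntegrableOn (fun x => f x * g x) Ω := fun hf hg =>
    memLp_one_iff_integrable.1 (memLp_restrict_of_isBounded hΩb (hf.mul hg) 1)
  rw [eq_sub_iff_add_eq, ← integral_add (hint ha.continuous (continuous_pderiv hu k))
    (hint (continuous_pderiv ha k) hu.continuous)]
  simp only [← pderiv_mul (ha.differentiable one_ne_zero _) (hu.differentiable one_ne_zero _)]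
  refine (integral_fderiv_eq_integral_surf hΩ hΩb hΩ2 (ha.mul hu) _).trans ?_
  simp [EuclideanSpace.inner_single_right, mul_right_comm]

theorem IsTrace.integral_mul_weakGrad (h : IsTrace Ω P g) (hΩ : IsOpen Ω)
    (hΩb : Bornology.IsBounded Ω) (hΩ2 : HasC2Boundary Ω) {a : Vec3 → ℝ} (ha : ContDiff ℝ 1 a)
    (i j k : Fin 3) :
    ∫ x in Ω, a x * weakGrad Ω P x i j k =
      (∫ x, a x * outerNormal Ω x k * g x i j ∂surf Ω) - ∫ x in Ω, pderiv k a x * P x i j := by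
  obtain ⟨hP, hg, Q, hQ, hQP, hQgrad, hQg⟩ := h
  have hweak := hasWeakGrad_weakGrad hP
  have hbulk : ∀ {u : Vec3 → ℝ}, Continuous u → MemLp u 2 (volume.restrict Ω) := fun hu =>
    memLp_restrict_of_isBounded hΩb hu 2
  have hboundary : ∀ {u : Vec3 → ℝ}, ContinuousOn u (frontier Ω) → MemLp u 2 (surf Ω) := fun hu =>
    memLp_surf_of_continuousOn hΩ hΩb hΩ2 hu 2
  have hleft := tendsto_integral_mul_of_tendsto_eLpNorm (hbulk ha.continuous) (hweak.2.1 i j k)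
    (fun n => hbulk (continuous_pderiv (hQ n i j) k)) (hQgrad i j k)
  have hvolume := tendsto_integral_mul_of_tendsto_eLpNorm (hbulk (continuous_pderiv ha k))
    (hweak.1 i j) (fun n => hbulk (hQ n i j).continuous) (hQP i j)
  have hsurf := tendsto_integral_mul_of_tendsto_eLpNorm
    (hboundary (ha.continuous.continuousOn.mul (continuousOn_outerNormal_apply hΩ hΩ2 k)))
    (hg i j) (fun n => hboundary (hQ n i j).continuous.continuousOn) (hQg i j)
  refine tendsto_nhds_unique hleft ((hsurf.sub hvolume).congr fun n => ?_)
  exact (integral_mul_pderiv hΩ hΩb hΩ2 ha (hQ n i j) k).symm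

/-- Euclidean scalar product of third order tensors. -/
def tensorInner (M N : Tensor3) : ℝ := ∑ i, ∑ j, ∑ k, M i j k * N i j k

theorem integrable_tensorInner {X : Type*} [MeasurableSpace X] {μ : Measure X}
    {M N : X → Tensor3} (hM : ∀ i j k, MemLp (fun x => M x i j k) 2 μ)
    (hN : ∀ i j k, MemLp (fun x => N x i j k) 2 μ) :
    Integrable (fun x => tensorInner (M x) (N x)) μ :=
  integrable_finsetSum _ fun i _ => integrable_finsetSum _ fun j _ =>
    integrable_finsetSum _ fun k _ => (hM i j k).integrable_mul (hN i j k)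

theorem integrable_mdot {X : Type*} [MeasurableSpace X] {μ : Measure X} {A B : X → Mat3}
    (hA : ∀ i j, MemLp (fun x => A x i j) 2 μ) (hB : ∀ i j, MemLp (fun x => B x i j) 2 μ) :
    Integrable (fun x => mdot (A x) (B x)) μ :=
  integrable_finsetSum _ fun i _ => integrable_finsetSum _ fun j _ =>
    (hA i j).integrable_mul (hB i j)

theorem continuousOn_tdot_outerNormal (hΩ : IsOpen Ω) (hΩ2 : HasC2Boundary Ω)
    {m : Vec3 → Tensor3} (hm : ∀ i j k, Continuous fun x => m x i j k) (i j : Fin 3) :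
    ContinuousOn (fun x => tdot (m x) (outerNormal Ω x) i j) (frontier Ω) := by
  simp only [tdot, Matrix.of_apply]
  exact continuousOn_finsetSum _ fun k _ =>
    (hm i j k).continuousOn.mul (continuousOn_outerNormal_apply hΩ hΩ2 k)

theorem continuous_DIV {m : Vec3 → Tensor3} (hm : ∀ i j k, ContDiff ℝ 1 fun x => m x i j k)
    (i j : Fin 3) : Continuous fun x => DIV m x i j := by
  simp only [DIV, Matrix.of_apply]
  exact continuous_finsetSum _ fun k _ => continuous_pderiv (hm i j k) k

theorem integral_sum_sum_sum {X ι κ τ : Type*} [Fintype ι] [Fintype κ] [Fintype τ]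
    [MeasurableSpace X] {μ : Measure X} {f : ι → κ → τ → X → ℝ}
    (hf : ∀ i j k, Integrable (f i j k) μ) :
    ∫ x, ∑ i, ∑ j, ∑ k, f i j k x ∂μ = ∑ i, ∑ j, ∑ k, ∫ x, f i j k x ∂μ := by
  rw [integral_finsetSum _ fun i _ => integrable_finsetSum _ fun j _ =>
    integrable_finsetSum _ fun k _ => hf i j k]
  refine Finset.sum_congr rfl fun i _ => ?_
  rw [integral_finsetSum _ fun j _ => integrable_finsetSum _ fun k _ => hf i j k]
  exact Finset.sum_congr rfl fun j _ => integral_finsetSum _ fun k _ => hf i j k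

theorem IsTrace.integral_tensorInner_weakGrad (h : IsTrace Ω P g) (hΩ : IsOpen Ω)
    (hΩb : Bornology.IsBounded Ω) (hΩ2 : HasC2Boundary Ω) {m : Vec3 → Tensor3}
    (hm : ∀ i j k, ContDiff ℝ 1 fun x => m x i j k) :
    ∫ x in Ω, tensorInner (m x) (weakGrad Ω P x) =
      (∫ x, mdot (tdot (m x) (outerNormal Ω x)) (g x) ∂surf Ω) -
        ∫ x in Ω, mdot (DIV m x) (P x) := by
  have hweak := hasWeakGrad_weakGrad h.1
  have hleft_int : ∀ i j k, Integrable (fun x => m x i j k * weakGrad Ω P x i j k)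
      (volume.restrict Ω) := fun i j k =>
    (memLp_restrict_of_isBounded hΩb (hm i j k).continuous 2).integrable_mul (hweak.2.1 i j k)
  have hsurf_int : ∀ i j k, Integrable (fun x => m x i j k * outerNormal Ω x k * g x i j)
      (surf Ω) := fun i j k =>
    (memLp_surf_of_continuousOn hΩ hΩb hΩ2 ((hm i j k).continuous.continuousOn.mul
      (continuousOn_outerNormal_apply hΩ hΩ2 k)) 2).integrable_mul (h.2.1 i j)
  have hvolume_int : ∀ i j k, Integrable (fun x => pderiv k (fun y => m y i j k) x * P x i j)
      (volume.restrict Ω) := fun i j k =>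
    (memLp_restrict_of_isBounded hΩb (continuous_pderiv (hm i j k) k) 2).integrable_mul
      (hweak.1 i j)
  simp only [tensorInner, mdot, tdot, DIV, Matrix.of_apply, Finset.sum_mul]
  rw [integral_sum_sum_sum hleft_int, integral_sum_sum_sum hsurf_int,
    integral_sum_sum_sum hvolume_int]
  simp only [h.integral_mul_weakGrad hΩ hΩb hΩ2 (hm _ _ _), Finset.sum_sub_distrib]

end Green

/-! ### The curvature energy and its first variation -/

section ConstitutiveLaw

theorem linearMap_matrix_apply_eq_sum {R m n p q : Type*} [CommSemiring R] [Fintype m] [Fintype n]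
    [DecidableEq m] [DecidableEq n] (L : Matrix m n R →ₗ[R] Matrix p q R) (A : Matrix m n R)
    (i : p) (j : q) : L A i j = ∑ a, ∑ b, A a b * L (Matrix.single a b 1) i j := by
  conv_lhs => rw [Matrix.matrix_eq_sum_single A]
  simp only [map_sum, Matrix.sum_apply]
  refine Finset.sum_congr rfl fun a _ => Finset.sum_congr rfl fun b _ => ?_
  rw [← mul_one (A a b), ← smul_eq_mul, ← Matrix.smul_single, map_smul, Matrix.smul_apply,
    smul_eq_mul, smul_eq_mul, mul_one]

/-- The linear map `A ↦ dev (sym A)`, one of the three projections in the energy density. -/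
noncomputable def devSymMap : Mat3 →ₗ[ℝ] Mat3 where
  toFun A := dev (sym A)
  map_add' A B := by
    ext i j
    simp only [dev, sym, Matrix.transpose_add, Matrix.trace_smul, Matrix.trace_add,
      Matrix.sub_apply, Matrix.smul_apply, Matrix.add_apply, smul_eq_mul]
    ring
  map_smul' r A := by
    ext i j
    simp only [dev, sym, Matrix.transpose_smul, Matrix.trace_smul, Matrix.trace_add,
      Matrix.sub_apply, Matrix.smul_apply, Matrix.add_apply, smul_eq_mul, RingHom.id_apply]
    ring

/-- The linear map `A ↦ skew A`. -/
noncomputable def skewMap : Mat3 →ₗ[ℝ] Mat3 where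
  toFun := skew
  map_add' A B := by simp only [skew, Matrix.transpose_add]; module
  map_smul' r A := by simp only [skew, Matrix.transpose_smul, RingHom.id_apply]; module

/-- The linear map `A ↦ tr A · 1`, which is three times the projection onto spherical matrices. -/
def traceMap : Mat3 →ₗ[ℝ] Mat3 := (Matrix.traceLinearMap (Fin 3) ℝ ℝ).smulRight 1

theorem mdot_devSymMap (A B : Mat3) :
    mdot (devSymMap A) (devSymMap B) = mdot (devSymMap A) B := by
  simp only [mdot, devSymMap, dev, sym, Matrix.trace, LinearMap.coe_mk, AddHom.coe_mk,
    Fin.sum_univ_three, Matrix.sub_apply, Matrix.smul_apply, Matrix.add_apply, smul_eq_mul,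
    Matrix.transpose_apply, Matrix.diag_apply, Matrix.one_apply, Fin.reduceEq, if_true, if_false]
  ring

theorem mdot_skewMap (A B : Mat3) : mdot (skewMap A) (skewMap B) = mdot (skewMap A) B := by
  simp only [mdot, skewMap, skew, LinearMap.coe_mk, AddHom.coe_mk, Fin.sum_univ_three,
    Matrix.sub_apply, Matrix.smul_apply, Matrix.transpose_apply, smul_eq_mul]
  ring

theorem mdot_traceMap (A B : Mat3) :
    mdot (traceMap A) (traceMap B) = 3 * mdot (traceMap A) B := by
  simp only [mdot, traceMap, LinearMap.smulRight_apply, Matrix.traceLinearMap_apply, Matrix.trace,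
    Fin.sum_univ_three, Matrix.smul_apply, smul_eq_mul, Matrix.diag_apply, Matrix.one_apply,
    Fin.reduceEq, if_true, if_false]
  ring

theorem onSlices_add_smul (L : Mat3 →ₗ[ℝ] Mat3) (M N : Tensor3) (r : ℝ) :
    onSlices L (M + r • N) = onSlices L M + r • onSlices L N := by
  funext i j k
  have hslice : (Matrix.of fun i j => (M + r • N) i j k : Mat3) =
      Matrix.of (fun i j => M i j k) + r • Matrix.of fun i j => N i j k := rfl
  simp only [onSlices, hslice, map_add, map_smul]
  rfl

theorem onSlices_linearMap_apply (L : Mat3 →ₗ[ℝ] Mat3) (M : Tensor3) (i j k : Fin 3) :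
    onSlices L M i j k = ∑ a, ∑ b, M a b k * L (Matrix.single a b 1) i j :=
  linearMap_matrix_apply_eq_sum L _ i j

theorem tensorInner_eq_sum_mdot (M N : Tensor3) :
    tensorInner M N = ∑ k, mdot (Matrix.of fun i j => M i j k) (Matrix.of fun i j => N i j k) := by
  simp only [tensorInner, mdot, Matrix.of_apply, Fin.sum_univ_three]
  ring

theorem tensorInner_onSlices {L : Mat3 → Mat3} {r : ℝ}
    (hL : ∀ A B, mdot (L A) (L B) = r * mdot (L A) B) (M N : Tensor3) :
    tensorInner (onSlices L M) (onSlices L N) = r * tensorInner (onSlices L M) N := by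
  rw [tensorInner_eq_sum_mdot, tensorInner_eq_sum_mdot, Finset.mul_sum]
  exact Finset.sum_congr rfl fun k _ => hL _ _

theorem tensorInner_add_left (M M' N : Tensor3) :
    tensorInner (M + M') N = tensorInner M N + tensorInner M' N := by
  simp only [tensorInner, Pi.add_apply, add_mul, Finset.sum_add_distrib]

theorem tensorInner_smul_left (r : ℝ) (M N : Tensor3) :
    tensorInner (r • M) N = r * tensorInner M N := by
  simp only [tensorInner, Pi.smul_apply, smul_eq_mul, Finset.mul_sum, mul_assoc]

theorem tnormSq_eq_tensorInner (M : Tensor3) : tnormSq M = tensorInner M M := by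
  simp only [tnormSq, tensorInner, sq]

theorem tnormSq_add_smul (M N : Tensor3) (r : ℝ) :
    tnormSq (M + r • N) = tnormSq M + 2 * r * tensorInner M N + r ^ 2 * tnormSq N := by
  simp only [tnormSq, tensorInner, Finset.mul_sum, ← Finset.sum_add_distrib]
  refine Finset.sum_congr rfl fun i _ => Finset.sum_congr rfl fun j _ =>
    Finset.sum_congr rfl fun k _ => ?_
  simp only [Pi.add_apply, Pi.smul_apply, smul_eq_mul]
  ring

theorem tnormSq_onSlices_add_smul {L : Mat3 →ₗ[ℝ] Mat3} {s : ℝ}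
    (hL : ∀ A B, mdot (L A) (L B) = s * mdot (L A) B) (M N : Tensor3) (r : ℝ) :
    tnormSq (onSlices L (M + r • N)) = tnormSq (onSlices L M) +
      2 * r * (s * tensorInner (onSlices L M) N) + r ^ 2 * tnormSq (onSlices L N) := by
  rw [onSlices_add_smul, tnormSq_add_smul, tensorInner_onSlices hL]

/-- The moment stress as a function of `M = D P`; it is the gradient of the density `Wcurv c`. -/
noncomputable def curvStress (c : CurvParams) (M : Tensor3) : Tensor3 :=
  (c.μ * c.Lc ^ 2) • (c.a₁ • onSlices devSymMap M + c.a₂ • onSlices skewMap M +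
    (2 / 3 * c.a₃) • onSlices traceMap M)

theorem Wcurv_eq (c : CurvParams) (M : Tensor3) :
    Wcurv c M = c.μ * c.Lc ^ 2 / 2 * (c.a₁ * tnormSq (onSlices devSymMap M) +
      c.a₂ * tnormSq (onSlices skewMap M) + 2 / 9 * c.a₃ * tnormSq (onSlices traceMap M)) :=
  rfl

theorem tensorInner_curvStress (c : CurvParams) (M N : Tensor3) :
    tensorInner (curvStress c M) N = c.μ * c.Lc ^ 2 *
      (c.a₁ * tensorInner (onSlices devSymMap M) N + c.a₂ * tensorInner (onSlices skewMap M) N +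
        2 / 3 * c.a₃ * tensorInner (onSlices traceMap M) N) := by
  simp only [curvStress, tensorInner_smul_left, tensorInner_add_left]

theorem Wcurv_eq_tensorInner (c : CurvParams) (M : Tensor3) :
    Wcurv c M = 1 / 2 * tensorInner (curvStress c M) M := by
  have hdevSym := tensorInner_onSlices (r := 1) (fun A B => by rw [mdot_devSymMap, one_mul]) M M
  have hskew := tensorInner_onSlices (r := 1) (fun A B => by rw [mdot_skewMap, one_mul]) M M
  have htrace := tensorInner_onSlices mdot_traceMap M M
  rw [Wcurv_eq, tensorInner_curvStress, tnormSq_eq_tensorInner, tnormSq_eq_tensorInner,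
    tnormSq_eq_tensorInner, hdevSym, hskew, htrace]
  ring

theorem Wcurv_add_smul (c : CurvParams) (M N : Tensor3) (r : ℝ) :
    Wcurv c (M + r • N) =
      Wcurv c M + r * tensorInner (curvStress c M) N + r ^ 2 * Wcurv c N := by
  have hdevSym := tnormSq_onSlices_add_smul (s := 1)
    (fun A B => by rw [mdot_devSymMap, one_mul]) M N r
  have hskew := tnormSq_onSlices_add_smul (s := 1)
    (fun A B => by rw [mdot_skewMap, one_mul]) M N r
  have htrace := tnormSq_onSlices_add_smul mdot_traceMap M N r
  rw [Wcurv_eq, Wcurv_eq, Wcurv_eq, tensorInner_curvStress, hdevSym, hskew, htrace]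
  ring

end ConstitutiveLaw

section MomentStress

variable {P : Vec3 → Mat3}

theorem grad_linearMap (L : Mat3 →ₗ[ℝ] Mat3) (hP : ∀ i j, Differentiable ℝ fun x => P x i j)
    (x : Vec3) : grad (fun y => L (P y)) x = onSlices L (grad P x) := by
  funext i j k
  have hderiv : HasFDerivAt (fun y => L (P y) i j)
      (∑ a, ∑ b, L (Matrix.single a b 1) i j • fderiv ℝ (fun y => P y a b) x) x := by
    simp only [linearMap_matrix_apply_eq_sum L (P _)]
    exact HasFDerivAt.fun_sum fun a _ => HasFDerivAt.fun_sum fun b _ =>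
      (hP a b x).hasFDerivAt.mul_const _
  simp only [onSlices_linearMap_apply, grad, pderiv, hderiv.fderiv, sum_apply, smul_apply,
    smul_eq_mul, mul_comm]

theorem momentStress_eq_curvStress (c : CurvParams) (hP : ∀ i j, Differentiable ℝ fun x => P x i j)
    (x : Vec3) : momentStress c P x = curvStress c (grad P x) := by
  rw [curvStress, ← grad_linearMap devSymMap hP, ← grad_linearMap skewMap hP,
    ← grad_linearMap traceMap hP]
  rfl

theorem contDiff_onSlices {n : WithTop ℕ∞} {M : Vec3 → Tensor3} (L : Mat3 →ₗ[ℝ] Mat3)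
    (hM : ∀ i j k, ContDiff ℝ n fun x => M x i j k) (i j k : Fin 3) :
    ContDiff ℝ n fun x => onSlices L (M x) i j k := by
  simp only [onSlices_linearMap_apply]
  exact ContDiff.sum fun a _ => ContDiff.sum fun b _ => (hM a b k).mul contDiff_const

theorem contDiff_momentStress (c : CurvParams) (hP : ∀ i j, ContDiff ℝ 2 fun x => P x i j)
    (i j k : Fin 3) : ContDiff ℝ 1 fun x => momentStress c P x i j k := by
  have hslices : ∀ L : Mat3 →ₗ[ℝ] Mat3, ContDiff ℝ 1 fun x => onSlices L (grad P x) i j k :=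
    fun L => contDiff_onSlices L (fun i j => contDiff_pderiv (hP i j)) i j k
  simp only [momentStress_eq_curvStress c fun i j => (hP i j).differentiable two_ne_zero]
  exact contDiff_const.mul (((contDiff_const.mul (hslices devSymMap)).add
    (contDiff_const.mul (hslices skewMap))).add (contDiff_const.mul (hslices traceMap)))

theorem memLp_onSlices {X : Type*} [MeasurableSpace X] {μ : Measure X} {p : ℝ≥0∞}
    {M : X → Tensor3} (L : Mat3 →ₗ[ℝ] Mat3) (hM : ∀ i j k, MemLp (fun x => M x i j k) p μ)
    (i j k : Fin 3) : MemLp (fun x => onSlices L (M x) i j k) p μ := by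
  simp only [onSlices_linearMap_apply]
  exact memLp_finsetSum _ fun a _ => memLp_finsetSum _ fun b _ => (hM a b k).mul_const _

theorem memLp_curvStress {X : Type*} [MeasurableSpace X] {μ : Measure X} {p : ℝ≥0∞}
    {M : X → Tensor3} (c : CurvParams) (hM : ∀ i j k, MemLp (fun x => M x i j k) p μ)
    (i j k : Fin 3) : MemLp (fun x => curvStress c (M x) i j k) p μ :=
  ((((memLp_onSlices devSymMap hM i j k).const_mul c.a₁).add
    ((memLp_onSlices skewMap hM i j k).const_mul c.a₂)).add
    ((memLp_onSlices traceMap hM i j k).const_mul _)).const_mul _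

end MomentStress

section FirstVariation

variable {Ω : Set Vec3} {P δP g : Vec3 → Mat3} {G G' : Vec3 → Tensor3}

theorem HasWeakGrad.integrable_Wcurv (h : HasWeakGrad Ω P G) (c : CurvParams) :
    IntegrableOn (fun x => Wcurv c (G x)) Ω := by
  simp only [Wcurv_eq_tensorInner]
  exact (integrable_tensorInner (memLp_curvStress c h.2.1) h.2.1).const_mul _

theorem HasWeakGrad.curvEnergy_add_smul (h : HasWeakGrad Ω P G) (h' : HasWeakGrad Ω δP G')
    (hΩ : IsOpen Ω) (c : CurvParams) (t : ℝ) :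
    curvEnergy c Ω (P + t • δP) = (∫ x in Ω, Wcurv c (G x)) +
      t * (∫ x in Ω, tensorInner (curvStress c (G x)) (G' x)) +
      t ^ 2 * ∫ x in Ω, Wcurv c (G' x) := by
  have hlinear := (integrable_tensorInner (memLp_curvStress c h.2.1) h'.2.1).const_mul t
  have hquadratic := (h'.integrable_Wcurv c).const_mul (t ^ 2)
  have haffine : IntegrableOn (fun x => Wcurv c (G x) +
      t * tensorInner (curvStress c (G x)) (G' x)) Ω := (h.integrable_Wcurv c).add hlinear
  rw [← integral_const_mul, ← integral_const_mul, ← integral_add (h.integrable_Wcurv c) hlinear,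
    ← integral_add haffine hquadratic]
  refine integral_congr_ae ?_
  filter_upwards [(h.add_smul h' t).weakGrad_ae_eq hΩ] with x hx
  rw [hx]
  exact Wcurv_add_smul c (G x) (G' x) t

theorem HasWeakGrad.hasDerivAt_curvEnergy (h : HasWeakGrad Ω P G) (h' : HasWeakGrad Ω δP G')
    (hΩ : IsOpen Ω) (c : CurvParams) :
    HasDerivAt (fun t : ℝ => curvEnergy c Ω (P + t • δP))
      (∫ x in Ω, tensorInner (curvStress c (G x)) (G' x)) 0 := by
  simp only [h.curvEnergy_add_smul h' hΩ c]
  have hid := hasDerivAt_id (0 : ℝ)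
  simpa using! ((hid.mul_const _).const_add _).add ((hid.pow 2).mul_const _)

theorem IsTrace.hasDerivAt_curvEnergy (h : IsTrace Ω δP g) (hΩ : IsOpen Ω)
    (hΩb : Bornology.IsBounded Ω) (hΩ2 : HasC2Boundary Ω) (c : CurvParams)
    (hP : ∀ i j, ContDiff ℝ 2 fun x => P x i j) :
    HasDerivAt (fun t : ℝ => curvEnergy c Ω (P + t • δP))
      ((∫ x, mdot (tdot (momentStress c P x) (outerNormal Ω x)) (g x) ∂surf Ω) -
        ∫ x in Ω, mdot (DIV (momentStress c P) x) (δP x)) 0 := by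
  rw [← h.integral_tensorInner_weakGrad hΩ hΩb hΩ2 (contDiff_momentStress c hP)]
  simp only [momentStress_eq_curvStress c fun i j => (hP i j).differentiable two_ne_zero]
  exact (hasWeakGrad_grad hΩb fun i j => (hP i j).of_le one_le_two).hasDerivAt_curvEnergy
    (hasWeakGrad_weakGrad h.1) hΩ c

theorem IsTrace.curvVariation_eq (h : IsTrace Ω δP g) (hΩ : IsOpen Ω)
    (hΩb : Bornology.IsBounded Ω) (hΩ2 : HasC2Boundary Ω) (c : CurvParams)
    (hP : ∀ i j, ContDiff ℝ 2 fun x => P x i j) :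
    curvVariation c Ω P δP =
      (∫ x, mdot (tdot (momentStress c P x) (outerNormal Ω x)) (g x) ∂surf Ω) -
        ∫ x in Ω, mdot (DIV (momentStress c P) x) (δP x) :=
  (h.hasDerivAt_curvEnergy hΩ hΩb hΩ2 c hP).deriv

end FirstVariation

/-! ### Tensor algebra on the boundary -/

section TensorAlgebra

theorem mdot_smul_right (r : ℝ) (A B : Mat3) : mdot A (r • B) = r * mdot A B := by
  simp only [mdot, Matrix.smul_apply, smul_eq_mul, Finset.mul_sum, mul_left_comm]

theorem mdot_zero_left (B : Mat3) : mdot 0 B = 0 := by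
  simp only [mdot, Matrix.zero_apply, zero_mul, Finset.sum_const_zero]

theorem mdot_eq_trace (A B : Mat3) : mdot A B = (A * B.transpose).trace := rfl

theorem mdot_vecMulVec (A : Mat3) (a : Fin 3 → ℝ) (u : Vec3) :
    mdot A (Matrix.vecMulVec a u) = a ⬝ᵥ vdot A u := by
  rw [mdot_eq_trace, Matrix.transpose_vecMulVec, Matrix.mul_vecMulVec, Matrix.trace_vecMulVec,
    dotProduct_comm, vdot]

theorem mdot_single (A : Mat3) (i j : Fin 3) : mdot A (Matrix.single i j 1) = A i j := by
  rw [mdot_eq_trace, Matrix.transpose_single, Matrix.trace_mul_single]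
  simp

theorem vdot_smul (A : Mat3) (r : ℝ) (u : Vec3) : vdot A (r • u) = r • vdot A u :=
  Matrix.mulVec_smul A r _

theorem dyad_eq_vecMulVec (u : Vec3) : dyad u = Matrix.vecMulVec u u := rfl

theorem mul_dyad (A : Mat3) (u : Vec3) : A * dyad u = Matrix.vecMulVec (vdot A u) u := by
  rw [dyad_eq_vecMulVec, Matrix.mul_vecMulVec, vdot]

theorem mul_dyad_eq_zero_iff {u : Vec3} (hu : u ≠ 0) (A : Mat3) :
    A * dyad u = 0 ↔ vdot A u = 0 := by
  have hu' : (u : Fin 3 → ℝ) ≠ 0 := fun h => hu (PiLp.ext fun i => congrFun h i)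
  rw [mul_dyad, Matrix.vecMulVec_eq_zero, or_iff_left hu']

theorem dotProduct_self_eq_one {u : Vec3} (hu : ‖u‖ = 1) :
    (u : Fin 3 → ℝ) ⬝ᵥ u = 1 := by
  rw [← one_pow 2, ← hu, EuclideanSpace.real_norm_sq_eq]
  simp only [dotProduct, sq]

theorem mdot_mul_dyad {u : Vec3} (hu : ‖u‖ = 1) (A B : Mat3) :
    mdot (A * dyad u) (B * dyad u) = mdot A (B * dyad u) := by
  have hidem : dyad u * dyad u = dyad u := by
    rw [dyad_eq_vecMulVec, Matrix.vecMulVec_mul_vecMulVec, dotProduct_self_eq_one hu, one_smul]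
  have hsymm : (dyad u).transpose = dyad u := Matrix.transpose_vecMulVec _ _
  rw [mdot_eq_trace, mdot_eq_trace, Matrix.transpose_mul, hsymm, ← mul_assoc, mul_assoc A, hidem,
    mul_assoc]

theorem eq_mul_dyad_of_rowCross_eq_zero {u : Vec3} (hu : ‖u‖ = 1) {A : Mat3}
    (h : rowCross A u = 0) : A = A * dyad u := by
  ext i j
  have hrow : crossProduct (A i) u = 0 := congrFun h i
  have hexpand := congrFun (cross_cross_eq_smul_sub_smul' (u : Fin 3 → ℝ) (A i) u) j
  rw [hrow, map_zero, dotProduct_self_eq_one hu, one_smul] at hexpand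
  rw [mul_dyad, Matrix.vecMulVec_apply]
  exact sub_eq_zero.1 hexpand.symm

theorem rowCross_smul (r : ℝ) (A : Mat3) (u : Vec3) : rowCross (r • A) u = r • rowCross A u := by
  ext i j
  exact congrFun (LinearMap.map_smul₂ crossProduct r (A i) u) j

theorem rowCross_vecMulVec_smul (a : Fin 3 → ℝ) (r : ℝ) (w : Vec3) :
    rowCross (Matrix.vecMulVec a w) (r • w) = 0 := by
  ext i j
  have hrow : crossProduct (a i • (w : Fin 3 → ℝ)) (r • w) = 0 := by
    rw [LinearMap.map_smul₂, map_smul, cross_self, smul_zero, smul_zero]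
  exact congrFun hrow j

end TensorAlgebra

/-! ### Localization of the weak form -/

section Localization

theorem eq_zero_of_integral_contDiff_mul_eq_zero {E : Type*} [NormedAddCommGroup E]
    [NormedSpace ℝ E] [FiniteDimensional ℝ E] [MeasurableSpace E] [BorelSpace E] {μ : Measure E}
    {f : E → ℝ} {S U : Set E} {x₀ : E} (hμS : ∀ᵐ x ∂μ, x ∈ S) (hμ : ∀ V ∈ 𝓝 x₀, 0 < μ V)
    (hf : LocallyIntegrable f μ) (hfc : ContinuousWithinAt f S x₀) (hU : IsOpen U) (hx₀U : x₀ ∈ U)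
    (h : ∀ φ : E → ℝ, ContDiff ℝ (⊤ : ℕ∞) φ → HasCompactSupport φ → tsupport φ ⊆ U →
      ∫ x, φ x * f x ∂μ = 0) : f x₀ = 0 := by
  by_contra hne
  have hae := hU.ae_eq_zero_of_integral_contDiff_smul_eq_zero (hf.locallyIntegrableOn U) h
  have hV : {x | x ∈ S → f x ≠ 0} ∩ U ∈ 𝓝 x₀ :=
    inter_mem (eventually_nhdsWithin_iff.1 (hfc.eventually_ne hne)) (hU.mem_nhds hx₀U)
  refine (hμ _ hV).ne' (measure_eq_zero_iff_ae_notMem.2 ?_)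
  filter_upwards [hae, hμS] with x hx hxS hxV
  exact hxV.1 hxS (hx hxV.2)

/-- The weak form of the equilibrium problem for the moment stress `m`: the virtual work of `m`
vanishes on every `C¹` field whose tangential part is zero on `Γ`. -/
def IsWeakEquilibrium (Ω Γ : Set Vec3) (m : Vec3 → Tensor3) : Prop :=
  ∀ Q : Vec3 → Mat3, (∀ i j, ContDiff ℝ 1 fun x => Q x i j) → TangentiallyZero Ω Γ Q →
    ∫ x, mdot (tdot (m x) (outerNormal Ω x)) (Q x) ∂surf Ω = ∫ x in Ω, mdot (DIV m x) (Q x)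

variable {Ω Γ : Set Vec3} {m : Vec3 → Tensor3} {x₀ : Vec3}

theorem IsWeakEquilibrium.DIV_eq_zero (h : IsWeakEquilibrium Ω Γ m) (hΩ : IsOpen Ω)
    (hm : ∀ i j k, ContDiff ℝ 1 fun x => m x i j k) (hx₀ : x₀ ∈ Ω) : DIV m x₀ = 0 := by
  ext i j
  have hcont := continuous_DIV hm i j
  refine eq_zero_of_integral_contDiff_mul_eq_zero (μ := volume) (f := fun x => DIV m x i j)
    (Eventually.of_forall Set.mem_univ) (fun V hV => Measure.measure_pos_of_mem_nhds volume hV)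
    hcont.locallyIntegrable hcont.continuousWithinAt hΩ hx₀ fun φ hφ _ hφΩ => ?_
  have hφ_zero : ∀ x ∉ Ω, φ x = 0 := fun x hx =>
    image_eq_zero_of_notMem_tsupport fun hx' => hx (hφΩ hx')
  have hφ_frontier : ∀ᵐ x ∂surf Ω, φ x = 0 := by
    filter_upwards [ae_surf_mem_frontier Ω] with x hx
    exact hφ_zero x fun hxΩ => (hΩ.inter_frontier_eq.subset ⟨hxΩ, hx⟩ : x ∈ (∅ : Set Vec3))
  have htangential : TangentiallyZero Ω Γ fun x => φ x • Matrix.single i j 1 := by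
    filter_upwards [ae_restrict_of_ae hφ_frontier] with x hx
    rw [rowCross_smul, hx, zero_smul]
  have hboundary : ∫ x, φ x * tdot (m x) (outerNormal Ω x) i j ∂surf Ω = 0 := by
    refine integral_eq_zero_of_ae ?_
    filter_upwards [hφ_frontier] with x hx
    rw [hx, zero_mul, Pi.zero_apply]
  have hweak := h (fun x => φ x • Matrix.single i j 1)
    (fun a b => (hφ.of_le (by exact_mod_cast le_top)).mul contDiff_const) htangential
  simp only [mdot_smul_right, mdot_single, hboundary] at hweak
  rw [← setIntegral_eq_integral_of_forall_compl_eq_zero fun x hx => by rw [hφ_zero x hx, zero_mul]]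
  exact hweak.symm

theorem IsWeakEquilibrium.mdot_traction_eq_zero (h : IsWeakEquilibrium Ω Γ m) (hΩ : IsOpen Ω)
    (hΩb : Bornology.IsBounded Ω) (hΩ2 : HasC2Boundary Ω)
    (hm : ∀ i j k, ContDiff ℝ 1 fun x => m x i j k) (hx₀ : x₀ ∈ frontier Ω) {B : Vec3 → Mat3}
    (hB : ∀ i j, ContDiff ℝ 1 fun x => B x i j) {U : Set Vec3} (hU : IsOpen U) (hx₀U : x₀ ∈ U)
    (hBΓ : ∀ x ∈ U, x ∈ frontier Ω → x ∈ closure Γ → rowCross (B x) (outerNormal Ω x) = 0) :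
    mdot (tdot (m x₀) (outerNormal Ω x₀)) (B x₀) = 0 := by
  have hcont : ContinuousOn (fun x => mdot (tdot (m x) (outerNormal Ω x)) (B x)) (frontier Ω) :=
    continuousOn_finsetSum _ fun i _ => continuousOn_finsetSum _ fun j _ =>
      (continuousOn_tdot_outerNormal hΩ hΩ2 (fun i j k => (hm i j k).continuous) i j).mul
        (hB i j).continuous.continuousOn
  have hint := memLp_one_iff_integrable.1 (memLp_surf_of_continuousOn hΩ hΩb hΩ2 hcont 1)
  refine eq_zero_of_integral_contDiff_mul_eq_zero
    (f := fun x => mdot (tdot (m x) (outerNormal Ω x)) (B x)) (ae_surf_mem_frontier Ω)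
    (fun V hV => surf_pos_of_mem_nhds hΩ hΩ2 hx₀ hV) hint.locallyIntegrable (hcont x₀ hx₀)
    hU hx₀U fun φ hφ _ hφU => ?_
  have htangential : TangentiallyZero Ω Γ fun x => φ x • B x := by
    refine ae_mono (Measure.restrict_mono subset_closure le_rfl)
      ((ae_restrict_iff' isClosed_closure.measurableSet).2 ?_)
    filter_upwards [ae_surf_mem_frontier Ω] with x hx hxΓ
    rw [rowCross_smul]
    by_cases hxφ : x ∈ tsupport φ
    · rw [hBΓ x (hφU hxφ) hx hxΓ, smul_zero]
    · rw [image_eq_zero_of_notMem_tsupport hxφ, zero_smul]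
  have hbulk : ∫ x in Ω, mdot (DIV m x) (φ x • B x) = 0 :=
    setIntegral_eq_zero_of_forall_eq_zero fun x hx => by
      rw [h.DIV_eq_zero hΩ hm hx, mdot_zero_left]
  have hweak := h (fun x => φ x • B x)
    (fun i j => (hφ.of_le (by exact_mod_cast le_top)).mul (hB i j)) htangential
  simpa only [mdot_smul_right] using hweak.trans hbulk

theorem IsWeakEquilibrium.traction_eq_zero (h : IsWeakEquilibrium Ω Γ m) (hΩ : IsOpen Ω)
    (hΩb : Bornology.IsBounded Ω) (hΩ2 : HasC2Boundary Ω)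
    (hm : ∀ i j k, ContDiff ℝ 1 fun x => m x i j k) (hx₀ : x₀ ∈ frontier Ω \ closure Γ) :
    tdot (m x₀) (outerNormal Ω x₀) = 0 := by
  ext i j
  refine (mdot_single _ i j).symm.trans ?_
  exact h.mdot_traction_eq_zero hΩ hΩb hΩ2 hm hx₀.1 (B := fun _ => Matrix.single i j 1)
    (fun _ _ => contDiff_const) isClosed_closure.isOpen_compl hx₀.2
    fun x hx _ hxΓ => absurd hxΓ hx

theorem gradient_apply (ρ : Vec3 → ℝ) (x : Vec3) (j : Fin 3) : gradient ρ x j = pderiv j ρ x := by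
  rw [pderiv, ← inner_gradient_left, EuclideanSpace.inner_single_right]
  simp

theorem IsWeakEquilibrium.vdot_traction_eq_zero (h : IsWeakEquilibrium Ω Γ m) (hΩ : IsOpen Ω)
    (hΩb : Bornology.IsBounded Ω) (hΩ2 : HasC2Boundary Ω)
    (hm : ∀ i j k, ContDiff ℝ 1 fun x => m x i j k) (hx₀ : x₀ ∈ frontier Ω) :
    vdot (tdot (m x₀) (outerNormal Ω x₀)) (outerNormal Ω x₀) = 0 := by
  obtain ⟨ρ, hρ⟩ := hΩ2 x₀ hx₀
  obtain ⟨U, hUρ, hU, hx₀U⟩ := eventually_nhds_iff.1 hρ.eventually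
  -- The normal need not be `C¹` off the boundary, so the test field is built from `∇ρ`.
  have hgradient : vdot (tdot (m x₀) (outerNormal Ω x₀)) (gradient ρ x₀) = 0 := by
    funext i
    rw [Pi.zero_apply, ← single_one_dotProduct i (vdot _ _), ← mdot_vecMulVec]
    refine h.mdot_traction_eq_zero hΩ hΩb hΩ2 hm hx₀
      (B := fun x : Vec3 => Matrix.vecMulVec (Pi.single i 1) (gradient ρ x : Vec3))
      (fun a b => ?_) hU hx₀U fun x hxU hx _ => ?_
    · simp only [Matrix.vecMulVec_apply, gradient_apply]
      exact contDiff_const.mul (contDiff_pderiv hρ.1 b)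
    · rw [outerNormal_eq hΩ hx (hUρ x hxU), rowCross_vecMulVec_smul]
  nth_rewrite 2 [outerNormal_eq hΩ hx₀ hρ]
  rw [vdot_smul, hgradient, smul_zero]

end Localization

/-! ### The first variation on the constrained space -/

section FirstVariation

variable {Ω Γ : Set Vec3} {P : Vec3 → Mat3}

theorem TangentiallyZero.ae_eq_mul_dyad {g : Vec3 → Mat3} (hg : TangentiallyZero Ω Γ g)
    (hΩ : IsOpen Ω) (hΩ2 : HasC2Boundary Ω) :
    ∀ᵐ x ∂(surf Ω).restrict Γ, g x = g x * dyad (outerNormal Ω x) := by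
  filter_upwards [hg, ae_restrict_of_ae (ae_surf_mem_frontier Ω)] with x hx hx_frontier
  exact eq_mul_dyad_of_rowCross_eq_zero (norm_outerNormal hΩ hΩ2 hx_frontier) hx

theorem integral_surf_eq_add_of_null (hnull : surf Ω (closure Γ \ Γ) = 0) {f : Vec3 → ℝ}
    (hf : Integrable f (surf Ω)) :
    ∫ x, f x ∂surf Ω =
      (∫ x in Γ, f x ∂surf Ω) + ∫ x in frontier Ω \ closure Γ, f x ∂surf Ω := by
  have hdisjoint : Disjoint Γ (frontier Ω \ closure Γ) :=
    Set.disjoint_sdiff_right.mono_left subset_closure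
  have hmeas : MeasurableSet (frontier Ω \ closure Γ) :=
    isClosed_frontier.measurableSet.diff isClosed_closure.measurableSet
  rw [← setIntegral_union hdisjoint hmeas hf.integrableOn hf.integrableOn]
  refine (setIntegral_eq_integral_of_ae_compl_eq_zero ?_).symm
  filter_upwards [ae_surf_mem_frontier Ω, measure_eq_zero_iff_ae_notMem.1 hnull]
    with x hx hx_null hx_notMem
  obtain ⟨hxΓ, hx_diff⟩ := not_or.1 hx_notMem
  exact absurd ⟨not_not.1 fun hx_closure => hx_diff ⟨hx, hx_closure⟩, hxΓ⟩ hx_null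

theorem IsTrace.curvVariation_eq_of_tangentiallyZero {δP g : Vec3 → Mat3} (h : IsTrace Ω δP g)
    (hg : TangentiallyZero Ω Γ g) (hΩ : IsOpen Ω) (hΩb : Bornology.IsBounded Ω)
    (hΩ2 : HasC2Boundary Ω) (hnull : surf Ω (closure Γ \ Γ) = 0) (c : CurvParams)
    (hP : ∀ i j, ContDiff ℝ 2 fun x => P x i j) :
    curvVariation c Ω P δP =
      (∫ x in Γ, mdot (tdot (momentStress c P x) (outerNormal Ω x) * dyad (outerNormal Ω x))
          (g x * dyad (outerNormal Ω x)) ∂surf Ω) +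
      (∫ x in frontier Ω \ closure Γ,
          mdot (tdot (momentStress c P x) (outerNormal Ω x)) (g x) ∂surf Ω) -
      ∫ x in Ω, mdot (DIV (momentStress c P) x) (δP x) := by
  have htraction := continuousOn_tdot_outerNormal hΩ hΩ2 fun i j k =>
    (contDiff_momentStress c hP i j k).continuous
  have hint : Integrable (fun x => mdot (tdot (momentStress c P x) (outerNormal Ω x)) (g x))
      (surf Ω) :=
    integrable_mdot (fun i j => memLp_surf_of_continuousOn hΩ hΩb hΩ2 (htraction i j) 2) h.2.1
  rw [h.curvVariation_eq hΩ hΩb hΩ2 c hP, integral_surf_eq_add_of_null hnull hint]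
  congr 2
  refine integral_congr_ae ?_
  filter_upwards [hg.ae_eq_mul_dyad hΩ hΩ2, ae_restrict_of_ae (ae_surf_mem_frontier Ω)]
    with x hx hx_frontier
  rw [mdot_mul_dyad (norm_outerNormal hΩ hΩ2 hx_frontier), ← hx]

theorem isWeakEquilibrium_momentStress (hΩ : IsOpen Ω) (hΩb : Bornology.IsBounded Ω)
    (hΩ2 : HasC2Boundary Ω) {c : CurvParams} (hP : ∀ i j, ContDiff ℝ 2 fun x => P x i j)
    (h : ∀ δP, MemHsharp Ω Γ δP → curvVariation c Ω P δP = 0) :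
    IsWeakEquilibrium Ω Γ (momentStress c P) := by
  intro Q hQ hQΓ
  have htrace := isTrace_of_contDiff hΩ hΩb hΩ2 hQ
  have hzero := h Q ⟨Q, htrace, hQΓ⟩
  rw [htrace.curvVariation_eq hΩ hΩb hΩ2 c hP] at hzero
  exact sub_eq_zero.1 hzero

theorem mul_dyad_outerNormal_eq_zero_iff (hΩ : IsOpen Ω) (hΩ2 : HasC2Boundary Ω) {x : Vec3}
    (hx : x ∈ frontier Ω) (A : Mat3) :
    A * dyad (outerNormal Ω x) = 0 ↔ vdot A (outerNormal Ω x) = 0 := by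
  have hnorm := norm_outerNormal hΩ hΩ2 hx
  exact mul_dyad_eq_zero_iff (norm_ne_zero_iff.1 (hnorm ▸ one_ne_zero)) A

end FirstVariation

end Micromorphic

theorem mainTheorem2_general
    (Ω Γ : Set Vec3) (hΩ : IsOpen Ω) (hΩb : Bornology.IsBounded Ω) (hΩ2 : HasC2Boundary Ω)
    (hΓ : Γ ⊆ frontier Ω) (c : CurvParams) (P : Vec3 → Mat3)
    (hP : ∀ i j, ContDiff ℝ 2 (fun x => P x i j)) :
    (∀ δP g : Vec3 → Mat3, IsTrace Ω δP g → TangentiallyZero Ω Γ g →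
      (∀ᵐ x ∂(surf Ω).restrict Γ, g x = g x * dyad (outerNormal Ω x)) ∧
      DifferentiableAt ℝ (fun t : ℝ => curvEnergy c Ω (P + t • δP)) 0 ∧
      (surf Ω (closure Γ \ Γ) = 0 →
        curvVariation c Ω P δP =
          (∫ x in Γ, mdot
              (tdot (momentStress c P x) (outerNormal Ω x) * dyad (outerNormal Ω x))
              (g x * dyad (outerNormal Ω x)) ∂(surf Ω)) +
          (∫ x in frontier Ω \ closure Γ,
              mdot (tdot (momentStress c P x) (outerNormal Ω x)) (g x) ∂(surf Ω)) -
          ∫ x in Ω, mdot (DIV (momentStress c P) x) (δP x))) ∧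
    ((∀ δP, MemHsharp Ω Γ δP → curvVariation c Ω P δP = 0) →
      (∀ x ∈ Ω, DIV (momentStress c P) x = 0) ∧
      (∀ x ∈ Γ,
        tdot (momentStress c P x) (outerNormal Ω x) * dyad (outerNormal Ω x) = 0) ∧
      (∀ x ∈ frontier Ω \ closure Γ, tdot (momentStress c P x) (outerNormal Ω x) = 0)) ∧
    (surf Ω (closure Γ \ Γ) = 0 →
      (∀ x ∈ Ω, DIV (momentStress c P) x = 0) →
      (∀ x ∈ Γ,
        tdot (momentStress c P x) (outerNormal Ω x) * dyad (outerNormal Ω x) = 0) →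
      (∀ x ∈ frontier Ω \ closure Γ, tdot (momentStress c P x) (outerNormal Ω x) = 0) →
      ∀ δP, MemHsharp Ω Γ δP → curvVariation c Ω P δP = 0) ∧
    (∀ x ∈ Γ,
      (tdot (momentStress c P x) (outerNormal Ω x) * dyad (outerNormal Ω x) = 0 ↔
        vdot (tdot (momentStress c P x) (outerNormal Ω x)) (outerNormal Ω x) = 0)) := by
  have hdyad : ∀ x ∈ Γ, ∀ A : Mat3,
      A * dyad (outerNormal Ω x) = 0 ↔ vdot A (outerNormal Ω x) = 0 := fun x hx A =>
    mul_dyad_outerNormal_eq_zero_iff hΩ hΩ2 (hΓ hx) A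
  refine ⟨fun δP g hδP hg => ⟨hg.ae_eq_mul_dyad hΩ hΩ2, ?_, fun hnull => ?_⟩, fun h => ?_,
    fun hnull hbulk hnormal hfree δP hδP => ?_, fun x hx => hdyad x hx _⟩
  · exact (hδP.hasDerivAt_curvEnergy hΩ hΩb hΩ2 c hP).differentiableAt
  · exact hδP.curvVariation_eq_of_tangentiallyZero hg hΩ hΩb hΩ2 hnull c hP
  · have hweak := isWeakEquilibrium_momentStress hΩ hΩb hΩ2 hP h
    have hm := contDiff_momentStress c hP
    exact ⟨fun x hx => hweak.DIV_eq_zero hΩ hm hx,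
      fun x hx => (hdyad x hx _).2 (hweak.vdot_traction_eq_zero hΩ hΩb hΩ2 hm (hΓ hx)),
      fun x hx => hweak.traction_eq_zero hΩ hΩb hΩ2 hm hx⟩
  · obtain ⟨g, htrace, hg⟩ := hδP
    rw [htrace.curvVariation_eq_of_tangentiallyZero hg hΩ hΩb hΩ2 hnull c hP,
      setIntegral_eq_zero_of_forall_eq_zero fun x hx => by rw [hnormal x hx, mdot_zero_left],
      setIntegral_eq_zero_of_forall_eq_zero fun x hx => by rw [hfree x hx, mdot_zero_left],
      setIntegral_eq_zero_of_forall_eq_zero fun x hx => by rw [hbulk x hx, mdot_zero_left],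
      add_zero, sub_zero]

theorem mainTheorem2
    (Ω Γ : Set Vec3) (hΩ : IsOpen Ω) (hΩb : Bornology.IsBounded Ω) (hΩ2 : HasC2Boundary Ω)
    (hΓ : ∃ O : Set Vec3, IsOpen O ∧ Γ = O ∩ frontier Ω)
    (c : CurvParams)
    (P : Vec3 → Mat3) (hP : ∀ i j, ContDiff ℝ 2 (fun x => P x i j)) (hPs : MemHsharp Ω Γ P) :
    -- the first variation in an admissible direction `δP` with boundary values `g`
    (∀ δP g : Vec3 → Mat3, IsTrace Ω δP g → TangentiallyZero Ω Γ g →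
      (∀ᵐ x ∂(surf Ω).restrict Γ, g x = g x * dyad (outerNormal Ω x)) ∧
      DifferentiableAt ℝ (fun t : ℝ => curvEnergy c Ω (P + t • δP)) 0 ∧
      (surf Ω (closure Γ \ Γ) = 0 →
        curvVariation c Ω P δP =
          (∫ x in Γ, mdot
              (tdot (momentStress c P x) (outerNormal Ω x) * dyad (outerNormal Ω x))
              (g x * dyad (outerNormal Ω x)) ∂(surf Ω)) +
          (∫ x in frontier Ω \ closure Γ,
              mdot (tdot (momentStress c P x) (outerNormal Ω x)) (g x) ∂(surf Ω)) -
          ∫ x in Ω, mdot (DIV (momentStress c P) x) (δP x))) ∧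
    -- vanishing of the first variation yields the bulk equation and the boundary conditions
    ((∀ δP, MemHsharp Ω Γ δP → curvVariation c Ω P δP = 0) →
      (∀ x ∈ Ω, DIV (momentStress c P) x = 0) ∧
      (∀ x ∈ Γ,
        tdot (momentStress c P x) (outerNormal Ω x) * dyad (outerNormal Ω x) = 0) ∧
      (∀ x ∈ frontier Ω \ closure Γ, tdot (momentStress c P x) (outerNormal Ω x) = 0)) ∧
    -- and conversely
    (surf Ω (closure Γ \ Γ) = 0 →
      (∀ x ∈ Ω, DIV (momentStress c P) x = 0) →
      (∀ x ∈ Γ,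
        tdot (momentStress c P x) (outerNormal Ω x) * dyad (outerNormal Ω x) = 0) →
      (∀ x ∈ frontier Ω \ closure Γ, tdot (momentStress c P x) (outerNormal Ω x) = 0) →
      ∀ δP, MemHsharp Ω Γ δP → curvVariation c Ω P δP = 0) ∧
    -- the two forms of the new Neumann-type condition on `Γ` are equivalent
    (∀ x ∈ Γ,
      (tdot (momentStress c P x) (outerNormal Ω x) * dyad (outerNormal Ω x) = 0 ↔
        vdot (tdot (momentStress c P x) (outerNormal Ω x)) (outerNormal Ω x) = 0)) := by
  obtain ⟨O, -, rfl⟩ := hΓ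
  exact mainTheorem2_general Ω _ hΩ hΩb hΩ2 Set.inter_subset_right c P hP
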